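/- Let $m\ge 3$ be an integer and $n=\frac{3^m-1}{2}$. For $0\le s<n$ let $C_s=\{s\,3^j \bmod n : j\ge 0\}\subseteq\{0,1,\dots,n-1\}$ be the $3$-cyclotomic coset of $s$ modulo $n$; the smallest element of $C_s$ is called its coset leader. Let $\delta_1$ be the largest of all coset leaders modulo $n$. Let $\alpha$ be a generator of $\mathrm{GF}(3^m)^*$ and $\beta=\alpha^{(3^m-1)/n}$, a primitive $n$-th root of unity, and let $m_i(x)$ be the minimal polynomial of $\beta^i$ over $\mathrm{GF}(3)$. Let $\mathcal C=\mathcal C_{(n,3,m,\delta_1)}$ be the narrow-sense BCH code of designed distance $\delta_1$, that is, the ternary cyclic code of length $n$ with generator polynomial $\mathrm{lcm}(m_1(x),m_2(x),\dots,m_{\delta_1-1}(x))$: it consists of all $(c_0,\dots,c_{n-1})\in\mathrm{GF}(3)^n$ for which the class of $\sum_i c_ix^i$ lies in the ideal of $\mathrm{GF}(3)[x]/(x^n-1)$ generated by this polynomial. Then $\mathcal C$ has length $n$, minimum Hamming distance exactly $\delta_1$, and dimension $k$ with $k=m+1$ if $m$ is odd and $k=\frac{m+2}{2}$ if $m$ is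 even. That is, $\mathcal C$ has parameters $\left[\frac{3^m-1}{2},k,\delta_1\right]$. If $m$ is even, the nonzero codewords of $\mathcal C$ have exactly three distinct Hamming weights, and the weight distribution of $\mathcal C$ (weight: number of codewords of that weight) is $$0:\ 1,\qquad 3^{m-1}-\tfrac{3^{m/2-1}+1}{2}:\ 2(3^{m/2}-1),\qquad 3^{m-1}+3^{m/2-1}:\ 3^{m/2}-1,\qquad \tfrac{3^m-1}{2}:\ 2,$$ and no other weights occur. If $m$ is odd, the nonzero codewords of $\mathcal C$ have exactly four distinct Hamming weights, and the weight distribution of $\mathcal C$ is $$0:\ 1,\qquad 3^{m-1}:\ 3^m-1,\qquad 3^{m-1}-\tfrac{1+(-1)^{(m-1)/2}3^{(m-1)/2}}{2}:\ 3^m-1,$$ $$3^{m-1}-\tfrac{1+(-1)^{(m+1)/2}3^{(m-1)/2}}{2}:\ 3^m-1,\qquad \tfrac{3^m-1}{2}:\ 2,$$ and no other weights occur. -/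

import Mathlib

open Polynomial

/-- The `q`-cyclotomic coset `{s, sq, sq², …} mod n` of `s`, each residue class modulo `n` being
represented by its least nonnegative element. -/
def cyclotomicCoset (q n s : ℕ) : Set ℕ :=
  {t | ∃ j : ℕ, t = (s * q ^ j) % n}

/-- The set of all coset leaders modulo `n`: the least elements of the `q`-cyclotomic cosets of
`t = 0, …, n - 1`. -/
def cosetLeaders (q n : ℕ) : Set ℕ :=
  {s | ∃ t : ℕ, t < n ∧ IsLeast (cyclotomicCoset q n t) s}

/-- The generator polynomial `lcm (m₁(x), m₂(x), …, m_{δ-1}(x))`, where `mᵢ(x)` is the minimal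
polynomial of `β ^ i` over `K` and the lcm is taken to be monic. -/
noncomputable def bchGenerator (K : Type*) [Field K] {F : Type*} [Field F] [Algebra K F]
    (β : F) (δ : ℕ) : K[X] :=
  letI := Classical.decEq K
  letI := UniqueFactorizationMonoid.toNormalizedGCDMonoid K[X]
  (Finset.Icc 1 (δ - 1)).lcm fun i => minpoly K (β ^ i)

/-- The cyclic code of length `n` over `K` generated by `g`: the vectors `(c₀, …, c_{n-1})` for which
the class of `c₀ + c₁ x + ⋯ + c_{n-1} x^{n-1}` lies in the ideal `⟨g⟩` of `K[x]/(x^n - 1)`. -/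
noncomputable def cyclicCode {K : Type*} [Field K] (n : ℕ) (g : K[X]) :
    Submodule K (Fin n → K) :=
  Submodule.comap
    ((Ideal.Quotient.mkₐ K (Ideal.span {(X ^ n - 1 : K[X])})).toLinearMap ∘ₗ
      Fintype.linearCombination K (fun i : Fin n => (X ^ (i : ℕ) : K[X])))
    ((Ideal.span {Ideal.Quotient.mk (Ideal.span {(X ^ n - 1 : K[X])}) g}).restrictScalars K)

/-- The narrow-sense BCH code of length `n` over `K` with designed distance `δ`, with respect to the
`n`-th root of unity `β`. -/
noncomputable def bchCode (K : Type*) [Field K] {F : Type*} [Field F] [Algebra K F]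
    (n : ℕ) (β : F) (δ : ℕ) : Submodule K (Fin n → K) :=
  cyclicCode n (bchGenerator K β δ)

section Codes

variable {K : Type*} [Field K] [DecidableEq K] {n : ℕ}

/-- `d` is the minimum Hamming distance between two distinct codewords of `C`. -/
def IsMinDistance (C : Submodule K (Fin n → K)) (d : ℕ) : Prop :=
  IsLeast {e | ∃ c ∈ C, ∃ c' ∈ C, c ≠ c' ∧ hammingDist c c' = e} d

/-- The set of Hamming weights of the nonzero codewords of `C`. -/
def nonzeroWeights (C : Submodule K (Fin n → K)) : Set ℕ :=
  {w | ∃ c ∈ C, c ≠ 0 ∧ hammingNorm c = w}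

/-- `C` has exactly `t` nonzero weights. -/
def IsWeightCode (C : Submodule K (Fin n → K)) (t : ℕ) : Prop :=
  (nonzeroWeights C).Finite ∧ (nonzeroWeights C).ncard = t

/-- The number of codewords of `C` of Hamming weight `w`. -/
noncomputable def weightFrequency (C : Submodule K (Fin n → K)) (w : ℚ) : ℕ :=
  {c : Fin n → K | c ∈ C ∧ (hammingNorm c : ℚ) = w}.ncard

end Codes

/-! Put h = ⌊(m-1)/2⌋ and read 2(n-s) as a ternary word of length m. Multiplying s by 3 modulo n
rotates this word, so coset leaders correspond to largest rotations. The value is even and nonzero,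
so the word is never a single digit 1, and the smallest possible largest rotation belongs to two
digits 1 spread as evenly as possible. Hence 2(n-δ₁) = 3^(m-1) + 3^h (`isGreatest_cosetLeaders_eq`).

As δ₁ is the largest leader, the values c(β^i) of a codeword vanish outside the cosets of 0 and δ₁,
so c(1) and c(β^δ₁) determine c. Conversely the words t ↦ a + Tr(b θ^t) with θ = β^(-3δ₁) are
codewords, and comparing cardinalities shows that they exhaust the code
(`exists_linearEquiv_bchCode`).

For a generator g of F* with β = g², θ = g^(3^(h+1)+1), so weights count the values of Q(x) = Tr(b
x^(3^(h+1)+1)) at x = g^t, one x from each pair ±x. For m odd, Q is a nondegenerate quadratic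
function when b ≠ 0 (`polarTrace_ne_zero`), and its value counts are known up to a swap
(`card_fiber_of_quadratic`). For m even, θ generates the multiplicative group of GF(3^(m/2)), b runs
over that subfield, and Tr(b θ^t) repeats the values of a nonzero linear functional on it
(`hammingNorm_traceWord_of_even`). -/

/-! ### Ternary words and the largest coset leader. -/

/-- Every even `v` with `0 < v < 3 ^ m` has a cyclic shift of its ternary expansion of value at
least `3 ^ (m - 1) + 3 ^ h`, as soon as `2 * h + 1 ≤ m`. -/
theorem exists_large_shift {m h v : ℕ} (hm : 2 * h + 1 ≤ m) (hv0 : 0 < v) (hv : v < 3 ^ m)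
    (hev : Even v) :
    ∃ j w, v * 3 ^ j ≡ w [MOD 3 ^ m - 1] ∧ 3 ^ (m - 1) + 3 ^ h ≤ w ∧ w < 3 ^ m := by
  have h1 : 3 ^ m ≡ 1 [MOD 3 ^ m - 1] :=
    ((Nat.modEq_iff_dvd' (Nat.one_le_pow _ _ (by norm_num))).2 dvd_rfl).symm
  obtain ⟨e, he⟩ : ∃ e, Nat.log 3 v = e := ⟨_, rfl⟩
  have hle : 3 ^ e ≤ v := he ▸ Nat.pow_log_le_self 3 hv0.ne'
  have hlt : v < 3 ^ (e + 1) := he ▸ Nat.lt_pow_succ_log_self (by norm_num) v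
  have hem : e < m := (Nat.pow_lt_pow_iff_right (by norm_num : 1 < 3)).1 (hle.trans_lt hv)
  obtain ⟨d, rfl⟩ : ∃ d, m = e + 1 + d := ⟨m - (e + 1), by omega⟩
  have hlow : 3 ^ (e + d) ≤ v * 3 ^ d := by rw [pow_add]; gcongr
  have hupp : v * 3 ^ d < 3 ^ (e + 1 + d) := by rw [pow_add]; gcongr
  have hm1 : e + 1 + d - 1 = e + d := by omega
  rw [hm1]
  by_cases hbig : 3 ^ (e + d) + 3 ^ h ≤ v * 3 ^ d
  · exact ⟨d, _, rfl, hbig, hupp⟩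
  obtain ⟨u, hu⟩ : ∃ u, v * 3 ^ d = 3 ^ (e + d) + u := ⟨_, (Nat.add_sub_cancel' hlow).symm⟩
  have huh : u < 3 ^ h := by omega
  -- The leading digit is now 1. Alone it would have the odd value 3^(m-1), so parity forces a
  -- second nonzero digit.
  have hu0 : 0 < u := by
    rcases Nat.eq_zero_or_pos u with rfl | hpos
    · have h2 : Even (3 ^ (e + d)) := by
        rw [← Nat.add_zero (3 ^ (e + d)), ← hu]; exact hev.mul_right _
      exact absurd h2 (Nat.not_even_iff_odd.2 (Odd.pow (by decide)))
    · exact hpos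
  obtain ⟨f, hf⟩ : ∃ f, Nat.log 3 u = f := ⟨_, rfl⟩
  have fle : 3 ^ f ≤ u := hf ▸ Nat.pow_log_le_self 3 hu0.ne'
  have flt : u < 3 ^ (f + 1) := hf ▸ Nat.lt_pow_succ_log_self (by norm_num) u
  have hfh : f < h := (Nat.pow_lt_pow_iff_right (by norm_num : 1 < 3)).1 (fle.trans_lt huh)
  obtain ⟨g, hg⟩ : ∃ g, e + d = f + 1 + g := ⟨e + d - (f + 1), by omega⟩
  have hhg : h ≤ g := by omega
  -- Rotate by g + 1 more places: the leading digit of u moves from position f to m - 1, and the old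
  -- leading 1 wraps round to position g ≥ h.
  refine ⟨d + (g + 1), u * 3 ^ (g + 1) + 3 ^ g, ?_, ?_, ?_⟩
  · have : v * 3 ^ (d + (g + 1)) = u * 3 ^ (g + 1) + 3 ^ (e + 1 + d) * 3 ^ g := by
      rw [pow_add, ← mul_assoc, hu, add_mul, add_comm, ← pow_add, ← pow_add]
      congr 2; omega
    rw [this]
    simpa using (h1.mul_right (3 ^ g)).add_left (u * 3 ^ (g + 1))
  · have h3 : 3 ^ (e + d) ≤ u * 3 ^ (g + 1) := by
      rw [hg, show f + 1 + g = f + (g + 1) by omega, pow_add]; gcongr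
    have h4 : 3 ^ h ≤ 3 ^ g := Nat.pow_le_pow_right (by norm_num) hhg
    omega
  · have h5 : (u + 1) * 3 ^ (g + 1) ≤ 3 ^ (e + 1 + d) := by
      rw [show e + 1 + d = (f + 1) + (g + 1) by omega, pow_add 3 (f + 1)]; exact Nat.mul_le_mul_right _ flt
    have h6 : 3 ^ g < 3 ^ (g + 1) := Nat.pow_lt_pow_right (by norm_num) (by omega)
    rw [add_mul, one_mul] at h5
    omega

theorem pow_mul_add_modEq {m n k r : ℕ} (hn : 2 * n + 1 = 3 ^ m) : 3 ^ (k * m + r) ≡ 3 ^ r [MOD n] := by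
  have h1 : 3 ^ m ≡ 1 [MOD n] := by
    rw [← hn]; simp [Nat.ModEq, Nat.add_mod, Nat.mul_mod_left]
  have := (h1.pow k).mul_right (3 ^ r)
  rwa [one_pow, one_mul, ← pow_mul, mul_comm m k, ← pow_add] at this

/-- Complementation s ↦ 2(n-s) turns a small coset element into a large rotation. The hypothesis on
δ says 2(n-δ) = 3^(m-1) + 3^h, the bound of `exists_large_shift`. -/
theorem exists_small_coset_element {m h n δ s : ℕ} (hm : 2 * h + 1 ≤ m) (hn : 2 * n + 1 = 3 ^ m)
    (hδ : 2 * δ + 3 ^ h + 1 = 2 * 3 ^ (m - 1)) (hs : s < n) : ∃ j, (s * 3 ^ j) % n ≤ δ := by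
  obtain ⟨j, w, hw, hlow, hupp⟩ := exists_large_shift hm (v := 2 * (n - s)) (by omega) (by omega)
    (even_two_mul _)
  have h3m : 3 ^ m = 3 * 3 ^ (m - 1) := by rw [← pow_succ']; congr 1; omega
  rw [show 3 ^ m - 1 = 2 * n by omega] at hw
  have hwe : w % 2 = 0 := by
    have := hw.of_mul_right n
    rw [Nat.ModEq] at this
    rw [← this, mul_assoc]; simp
  obtain ⟨r, rfl⟩ : ∃ r, w = 2 * r := ⟨w / 2, by omega⟩
  rw [mul_assoc] at hw
  have hr : (n - s) * 3 ^ j ≡ r [MOD n] := Nat.ModEq.mul_left_cancel' (by norm_num) hw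
  refine ⟨j, ?_⟩
  have hsum : s * 3 ^ j + (n - s) * 3 ^ j = n * 3 ^ j := by
    rw [← add_mul]; congr 1; omega
  have key : s * 3 ^ j ≡ n - r [MOD n] := by
    apply Nat.ModEq.add_right_cancel hr
    rw [hsum, show n - r + r = n by omega]
    simp [Nat.ModEq]
  rw [key]
  exact (Nat.mod_le _ _).trans (by omega)

/-- The word 2(n-δ) has digits 1 at positions m-1 and h only. These are as far apart on the cycle as
possible, so no rotation has a larger value. -/
theorem le_coset_element {m h n δ : ℕ} (hm : 2 * h + 1 ≤ m) (hm' : m ≤ 2 * h + 2)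
    (hn : 2 * n + 1 = 3 ^ m) (hδ : 2 * δ + 3 ^ h + 1 = 2 * 3 ^ (m - 1)) (j : ℕ) :
    δ ≤ (δ * 3 ^ j) % n := by
  have hmpos : 0 < m := by omega
  have h3m : 3 ^ m = 3 * 3 ^ (m - 1) := by rw [← pow_succ']; congr 1; omega
  have hh3 : 3 ^ h ≤ 3 ^ (m - 1) := Nat.pow_le_pow_right (by norm_num) (by omega)
  have hpos : 0 < 3 ^ h := by positivity
  have hδn : δ < n := by omega
  -- reduce to `j < m`
  obtain ⟨i, hi, hij⟩ : ∃ i < m, 3 ^ j ≡ 3 ^ i [MOD n] := by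
    refine ⟨j % m, Nat.mod_lt _ hmpos, ?_⟩
    conv_lhs => rw [← Nat.div_add_mod' j m]
    exact pow_mul_add_modEq hn
  have hij' : (δ * 3 ^ j) % n = (δ * 3 ^ i) % n := hij.mul_left δ
  rw [hij']
  rcases Nat.eq_zero_or_pos i with rfl | hipos
  · rw [pow_zero, mul_one, Nat.mod_eq_of_lt hδn]
  have h3mn : 3 ^ m ≡ 1 [MOD 2 * n] := by
    rw [← hn]; simp [Nat.ModEq]
  -- the complementary word has exactly two nonzero digits
  suffices H : ∃ a b, 3 ^ (m - 1 + i) ≡ 3 ^ a [MOD 2 * n] ∧ 3 ^ (h + i) ≡ 3 ^ b [MOD 2 * n] ∧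
      3 ^ a + 3 ^ b ≤ 3 ^ (m - 1) + 3 ^ h by
    obtain ⟨a, b, ha, hb, hab⟩ := H
    have hao : 3 ^ a % 2 = 1 := Nat.odd_iff.1 (Odd.pow (by decide))
    have hbo : 3 ^ b % 2 = 1 := Nat.odd_iff.1 (Odd.pow (by decide))
    obtain ⟨r, hr⟩ : ∃ r, 3 ^ a + 3 ^ b = 2 * r := ⟨(3 ^ a + 3 ^ b) / 2, by omega⟩
    have e1 : 2 * ((n - δ) * 3 ^ i) = 3 ^ (m - 1 + i) + 3 ^ (h + i) := by
      rw [pow_add, pow_add, ← add_mul, ← mul_assoc]; congr 1; omega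
    have e2 : (n - δ) * 3 ^ i ≡ r [MOD n] := by
      apply Nat.ModEq.mul_left_cancel' (c := 2) (by norm_num)
      rw [e1, ← hr]
      exact ha.add hb
    have hsum : δ * 3 ^ i + (n - δ) * 3 ^ i = n * 3 ^ i := by
      rw [← add_mul]; congr 1; omega
    have key : δ * 3 ^ i ≡ n - r [MOD n] := by
      apply Nat.ModEq.add_right_cancel e2
      rw [hsum, show n - r + r = n by omega]
      simp [Nat.ModEq]
    have ha0 : 0 < 3 ^ a := by positivity
    have hb0 : 0 < 3 ^ b := by positivity
    rw [key, Nat.mod_eq_of_lt (by omega)]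
    omega
  have hwrap : ∀ c, 3 ^ (m + c) ≡ 3 ^ c [MOD 2 * n] := fun c => by
    simpa [pow_add] using h3mn.mul_right (3 ^ c)
  have h1 : 3 ^ (m - 1 + i) ≡ 3 ^ (i - 1) [MOD 2 * n] := by
    rw [show m - 1 + i = m + (i - 1) by omega]; exact hwrap _
  -- Does the digit from position h wrap round? If not, it takes over as the higher digit, and m ≤
  -- 2h + 2 keeps the other one at position i - 1 ≤ h.
  by_cases hc : h + i < m
  · refine ⟨i - 1, h + i, h1, rfl, ?_⟩
    have h4 : 3 ^ (i - 1) ≤ 3 ^ h := Nat.pow_le_pow_right (by norm_num) (by omega)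
    have h5 : 3 ^ (h + i) ≤ 3 ^ (m - 1) := Nat.pow_le_pow_right (by norm_num) (by omega)
    omega
  · refine ⟨i - 1, h + i - m, h1, ?_, ?_⟩
    · conv_lhs => rw [show h + i = m + (h + i - m) by omega]
      exact hwrap _
    have h4 : 3 ^ (i - 1) ≤ 3 ^ (m - 1) := Nat.pow_le_pow_right (by norm_num) (by omega)
    have h5 : 3 ^ (h + i - m) ≤ 3 ^ h := Nat.pow_le_pow_right (by norm_num) (by omega)
    omega

theorem isGreatest_cosetLeaders_eq {m h n δ δ₁ : ℕ} (hm : 2 * h + 1 ≤ m) (hm' : m ≤ 2 * h + 2)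
    (hn : 2 * n + 1 = 3 ^ m) (hδ : 2 * δ + 3 ^ h + 1 = 2 * 3 ^ (m - 1))
    (hδ₁ : IsGreatest (cosetLeaders 3 n) δ₁) : δ₁ = δ := by
  have h3m : 3 ^ m = 3 * 3 ^ (m - 1) := by rw [← pow_succ']; congr 1; omega
  have hpos : 0 < 3 ^ h := by positivity
  have hδn : δ < n := by
    have hh3 : 3 ^ h ≤ 3 ^ (m - 1) := Nat.pow_le_pow_right (by norm_num) (by omega)
    omega
  apply le_antisymm
  · obtain ⟨t, ht, -, hleast⟩ := hδ₁.1
    obtain ⟨j, hj⟩ := exists_small_coset_element hm hn hδ ht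
    exact (hleast ⟨j, rfl⟩).trans hj
  · refine hδ₁.2 ⟨δ, hδn, ⟨0, ?_⟩, ?_⟩
    · rw [pow_zero, mul_one, Nat.mod_eq_of_lt hδn]
    · rintro _ ⟨j, rfl⟩
      exact le_coset_element hm hm' hn hδ j

/-- A nonzero residue outside the coset of the largest coset leader `δ` lies in the coset of some
`i` with `0 < i < δ`. -/
theorem exists_modEq_of_isGreatest {m n δ j : ℕ} (hn : 2 * n + 1 = 3 ^ m) (hm : 0 < m)
    (hδ : IsGreatest (cosetLeaders 3 n) δ) (hj : j < n) (hj0 : j ≠ 0)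
    (hjδ : ∀ e, ¬ j ≡ δ * 3 ^ e [MOD n]) :
    ∃ i e, 1 ≤ i ∧ i < δ ∧ j ≡ i * 3 ^ e [MOD n] := by
  have hne : (cyclotomicCoset 3 n j).Nonempty := ⟨_, 0, rfl⟩
  have hleast : IsLeast (cyclotomicCoset 3 n j) (sInf (cyclotomicCoset 3 n j)) :=
    ⟨Nat.sInf_mem hne, fun x hx => Nat.sInf_le hx⟩
  obtain ⟨i, hi⟩ : ∃ i, sInf (cyclotomicCoset 3 n j) = i := ⟨_, rfl⟩
  rw [hi] at hleast
  obtain ⟨e, he⟩ := hleast.1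
  -- Since 3^(em) ≡ 1, the factor 3^(em-e) inverts 3^e.
  have hback : j ≡ i * 3 ^ (e * m - e) [MOD n] := by
    have h1 : i ≡ j * 3 ^ e [MOD n] := by rw [he]; exact Nat.mod_modEq _ _
    have h2 := h1.mul_right (3 ^ (e * m - e))
    rw [mul_assoc, ← pow_add, Nat.add_sub_cancel' (Nat.le_mul_of_pos_right _ hm)] at h2
    have h3 := (pow_mul_add_modEq (k := e) (r := 0) hn).mul_left j
    simp only [add_zero, pow_zero, mul_one] at h3
    exact (h2.trans h3).symm
  refine ⟨i, _, ?_, lt_of_le_of_ne (hδ.2 ⟨j, hj, hleast⟩) ?_, hback⟩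
  · rw [Nat.one_le_iff_ne_zero]
    rintro rfl
    rw [zero_mul] at hback
    exact hj0 (Nat.eq_zero_of_dvd_of_lt ((Nat.modEq_zero_iff_dvd).1 hback) hj)
  · rintro rfl
    exact hjδ _ hback

/-! ### Codewords and their values at powers of β. -/

theorem mem_cyclicCode_iff {K : Type*} [Field K] {n : ℕ} {g : K[X]} (hg : g ∣ X ^ n - 1)
    (c : Fin n → K) : c ∈ cyclicCode n g ↔ g ∣ ∑ i : Fin n, c i • (X ^ (i : ℕ) : K[X]) := by
  rw [cyclicCode, Submodule.mem_comap, Submodule.restrictScalars_mem, LinearMap.comp_apply,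
    Fintype.linearCombination_apply]
  change Ideal.Quotient.mk (Ideal.span {(X ^ n - 1 : K[X])}) _ ∈ _ ↔ _
  rw [Ideal.mem_span_singleton]
  refine ⟨?_, map_dvd _⟩
  rintro ⟨q, hq⟩
  obtain ⟨h, rfl⟩ := Ideal.Quotient.mk_surjective q
  rw [← map_mul, Ideal.Quotient.eq, Ideal.mem_span_singleton] at hq
  exact (dvd_sub_left (dvd_mul_right g h)).1 (hg.trans hq)

theorem bchGenerator_dvd_iff (K : Type*) [Field K] {F : Type*} [Field F] [Algebra K F]
    (β : F) (δ : ℕ) (p : K[X]) :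
    bchGenerator K β δ ∣ p ↔ ∀ i, 1 ≤ i → i < δ → aeval (β ^ i) p = 0 := by
  let := Classical.decEq K
  let := UniqueFactorizationMonoid.toNormalizedGCDMonoid K[X]
  refine Finset.lcm_dvd_iff.trans ?_
  simp only [Finset.mem_Icc, minpoly.dvd_iff]
  exact ⟨fun H i h1 h2 => H i ⟨h1, by omega⟩, fun H i hi => H i hi.1 (by omega)⟩

/-- The value at `β ^ i` of the polynomial with coefficient vector `c`. -/
def spectrumAt {K F : Type*} [Field K] [Field F] [Algebra K F] {n : ℕ} (β : F) (c : Fin n → K)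
    (i : ℕ) : F :=
  ∑ t : Fin n, algebraMap K F (c t) * (β ^ i) ^ (t : ℕ)

section Spectrum

variable {F : Type*} [Field F] {n : ℕ} {β : F}

theorem mem_bchCode_iff {K : Type*} [Field K] [Algebra K F] (hβ : β ^ n = 1) (δ : ℕ)
    (c : Fin n → K) :
    c ∈ bchCode K n β δ ↔ ∀ i, 1 ≤ i → i < δ → spectrumAt β c i = 0 := by
  rw [bchCode, mem_cyclicCode_iff, bchGenerator_dvd_iff]
  · simp [spectrumAt, map_sum, Algebra.smul_def]
  · rw [bchGenerator_dvd_iff]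
    intro i _ _
    simp [← pow_mul, mul_comm i n, pow_mul β n i, hβ]

theorem spectrumAt_sub {K : Type*} [Field K] [Algebra K F] (c d : Fin n → K) (i : ℕ) :
    spectrumAt β (c - d) i = spectrumAt β c i - spectrumAt β d i := by
  simp [spectrumAt, sub_mul]

theorem spectrumAt_zero_right {K : Type*} [Field K] [Algebra K F] (c : Fin n → K) :
    spectrumAt β c 0 = algebraMap K F (∑ t, c t) := by
  simp [spectrumAt]

theorem spectrumAt_congr {K : Type*} [Field K] [Algebra K F] (hβ : β ^ n = 1) (c : Fin n → K)
    {i j : ℕ} (hij : i ≡ j [MOD n]) : spectrumAt β c i = spectrumAt β c j := by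
  rw [spectrumAt, spectrumAt, pow_eq_pow_mod i hβ, pow_eq_pow_mod j hβ, hij]

/-- Vandermonde: the powers of β below n are distinct. -/
theorem eq_zero_of_spectrumAt_eq_zero {K : Type*} [Field K] [Algebra K F]
    (hβ : IsPrimitiveRoot β n) {c : Fin n → K} (hc : ∀ i < n, spectrumAt β c i = 0) : c = 0 := by
  have h := Matrix.eq_zero_of_forall_index_sum_pow_mul_eq_zero (R := F)
    (f := fun j : Fin n => β ^ (j : ℕ)) (v := fun i => algebraMap K F (c i))
    (fun i j hij => Fin.ext (hβ.pow_inj i.2 j.2 hij)) (fun j => by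
      rw [← hc j j.2, spectrumAt]
      exact Finset.sum_congr rfl fun i _ => mul_comm _ _)
  ext i
  exact (algebraMap K F).injective (by simpa using congrFun h i)

theorem sum_fin_pow_eq_zero {z : F} (hz : z ^ n = 1) (hz1 : z ≠ 1) : ∑ t : Fin n, z ^ (t : ℕ) = 0 := by
  rw [Fin.sum_univ_eq_sum_range (fun t => z ^ t)]
  refine eq_zero_of_ne_zero_of_mul_right_eq_zero (sub_ne_zero.2 hz1) ?_
  rw [geom_sum_mul, hz, sub_self]

variable [Algebra (ZMod 3) F]

theorem spectrumAt_pow_three (c : Fin n → ZMod 3) (i e : ℕ) :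
    spectrumAt β c (i * 3 ^ e) = spectrumAt β c i ^ 3 ^ e := by
  have : CharP F 3 := charP_of_injective_algebraMap (algebraMap (ZMod 3) F).injective 3
  have : Fact (Nat.Prime 3) := ⟨Nat.prime_three⟩
  rw [spectrumAt, spectrumAt, sum_pow_char_pow]
  refine Finset.sum_congr rfl fun t _ => ?_
  rw [mul_pow, ← map_pow, ZMod.pow_card_pow]
  congr 1
  rw [← pow_mul, ← pow_mul, ← pow_mul, mul_right_comm, mul_assoc]

/-- Every residue lies in the coset of 0, of δ, or of some i with 0 < i < δ. Frobenius spreads a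
zero over its whole coset, so all n values vanish. -/
theorem eq_zero_of_mem_bchCode {m δ : ℕ} (hn : 2 * n + 1 = 3 ^ m) (hm : 0 < m)
    (hβ : IsPrimitiveRoot β n) (hδ : IsGreatest (cosetLeaders 3 n) δ) {c : Fin n → ZMod 3}
    (hc : c ∈ bchCode (ZMod 3) n β δ) (h0 : ∑ t, c t = 0) (h1 : spectrumAt β c δ = 0) : c = 0 := by
  rw [mem_bchCode_iff hβ.pow_eq_one] at hc
  refine eq_zero_of_spectrumAt_eq_zero hβ fun j hj => ?_
  rcases eq_or_ne j 0 with rfl | hj0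
  · rw [spectrumAt_zero_right, h0, map_zero]
  by_cases hjδ : ∃ e, j ≡ δ * 3 ^ e [MOD n]
  · obtain ⟨e, he⟩ := hjδ
    rw [spectrumAt_congr hβ.pow_eq_one c he, spectrumAt_pow_three, h1, zero_pow (by positivity)]
  · obtain ⟨i, e, hi1, hiδ, hi⟩ := exists_modEq_of_isGreatest hn hm hδ hj hj0 (not_exists.1 hjδ)
    rw [spectrumAt_congr hβ.pow_eq_one c hi, spectrumAt_pow_three, hc i hi1 hiδ,
      zero_pow (by positivity)]

/-! ### Trace description of the code. -/

/-- The word `t ↦ a + Tr (b θ ^ t)`. -/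
noncomputable def traceWord (n : ℕ) (θ : F) : ZMod 3 × F →ₗ[ZMod 3] (Fin n → ZMod 3) where
  toFun p t := p.1 + Algebra.trace (ZMod 3) F (p.2 * θ ^ (t : ℕ))
  map_add' p q := by
    ext t; simp [add_mul]; ring
  map_smul' r p := by
    ext t; simp [mul_add]

theorem traceWord_apply (θ : F) (p : ZMod 3 × F) (t : Fin n) :
    traceWord n θ p t = p.1 + Algebra.trace (ZMod 3) F (p.2 * θ ^ (t : ℕ)) := rfl

/-- Expanding the trace into Frobenius powers makes the value at β^i a combination of geometric sums
over n-th roots of unity. One of them survives only if some θ^(3^e) β^i = 1, which would put i < δ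
in the coset of δ. -/
theorem traceWord_mem_bchCode [Finite F] {δ : ℕ} {θ : F} (hβ : IsPrimitiveRoot β n)
    (hδn : δ ≤ n) (hθ : θ * β ^ (3 * δ) = 1) (hδ : ∀ i e, i < δ → ¬ i ≡ δ * 3 ^ e [MOD n])
    (p : ZMod 3 × F) : traceWord n θ p ∈ bchCode (ZMod 3) n β δ := by
  rw [mem_bchCode_iff hβ.pow_eq_one]
  intro i hi1 hiδ
  have : CharP F 3 := charP_of_injective_algebraMap (algebraMap (ZMod 3) F).injective 3
  have hθn : θ ^ n = 1 := by
    have : (θ * β ^ (3 * δ)) ^ n = 1 := by rw [hθ, one_pow]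
    rwa [mul_pow, ← pow_mul, mul_comm (3 * δ) n, pow_mul, hβ.pow_eq_one, one_pow, mul_one] at this
  have hin : (β ^ i) ^ n = 1 := by rw [← pow_mul, mul_comm, pow_mul, hβ.pow_eq_one, one_pow]
  have expand : spectrumAt β (traceWord n θ p) i =
      algebraMap (ZMod 3) F p.1 * ∑ t : Fin n, (β ^ i) ^ (t : ℕ) +
      ∑ e ∈ Finset.range (Module.finrank (ZMod 3) F),
        p.2 ^ 3 ^ e * ∑ t : Fin n, (θ ^ 3 ^ e * β ^ i) ^ (t : ℕ) := by
    simp only [spectrumAt, traceWord_apply, map_add, FiniteField.algebraMap_trace_eq_sum_pow,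
      Nat.card_zmod, add_mul, Finset.sum_add_distrib, Finset.mul_sum, Finset.sum_mul]
    congr 1
    rw [Finset.sum_comm]
    refine Finset.sum_congr rfl fun e _ => Finset.sum_congr rfl fun t _ => ?_
    rw [mul_pow, mul_pow, ← pow_mul, ← pow_mul θ, mul_comm (t : ℕ), mul_assoc]
  rw [expand, sum_fin_pow_eq_zero hin (hβ.pow_ne_one_of_pos_of_lt (by omega) (by omega)), mul_zero,
    zero_add]
  refine Finset.sum_eq_zero fun e _ => ?_
  rw [sum_fin_pow_eq_zero, mul_zero]
  · rw [mul_pow, hin, mul_one, ← pow_mul, mul_comm, pow_mul, hθn, one_pow]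
  · intro h1
    apply hδ i (e + 1) hiδ
    rw [hβ.eq_orderOf]
    refine (isOfFinOrder_iff_pow_eq_one.2 ⟨n, by omega, hβ.pow_eq_one⟩).pow_eq_pow_iff_modEq.1 ?_
    have h2 : θ ^ 3 ^ e * β ^ (δ * 3 ^ (e + 1)) = 1 := by
      rw [show δ * 3 ^ (e + 1) = (3 * δ) * 3 ^ e by ring, pow_mul, ← mul_pow, hθ, one_pow]
    have hθ0 : θ ^ 3 ^ e ≠ 0 := left_ne_zero_of_mul_eq_one h2
    exact mul_left_cancel₀ hθ0 (h1.trans h2.symm)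

/-- If the words `traceWord (a, b)` with `b ∈ V` are pairwise distinct and the spectrum of the
code at `δ` takes values in `V`, then these words make up the whole code. -/
theorem exists_linearEquiv_bchCode [Finite F] {m δ : ℕ} {θ : F} (hn : 2 * n + 1 = 3 ^ m)
    (hm : 0 < m) (hβ : IsPrimitiveRoot β n) (hδ : IsGreatest (cosetLeaders 3 n) δ)
    (hθ : θ * β ^ (3 * δ) = 1) (V : Submodule (ZMod 3) F)
    (hV : ∀ c ∈ bchCode (ZMod 3) n β δ, spectrumAt β c δ ∈ V)
    (hinj : ∀ a : ZMod 3, ∀ b ∈ V, traceWord n θ (a, b) = 0 → a = 0 ∧ b = 0) :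
    ∃ e : (ZMod 3 × V) ≃ₗ[ZMod 3] bchCode (ZMod 3) n β δ,
      ∀ a b, ((e (a, b) : bchCode (ZMod 3) n β δ) : Fin n → ZMod 3) = traceWord n θ (a, b) := by
  obtain ⟨s, hs, hsl⟩ := hδ.1
  have hδn : δ ≤ n := by
    obtain ⟨j, rfl⟩ := hsl.1
    exact (Nat.mod_lt _ (by omega)).le
  have hδmod : ∀ i e, i < δ → ¬ i ≡ δ * 3 ^ e [MOD n] := by
    intro i e hi h
    obtain ⟨j, hj⟩ := hsl.1
    have h3 : i = (s * 3 ^ (j + e)) % n := by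
      rw [← Nat.mod_eq_of_lt (hi.trans_le hδn), h, pow_add, ← mul_assoc, hj]
      exact (Nat.mod_modEq _ _).mul_right _
    exact absurd (hsl.2 ⟨_, h3⟩) (not_le.2 hi)
  let f : (ZMod 3 × V) →ₗ[ZMod 3] bchCode (ZMod 3) n β δ :=
    ((traceWord n θ).comp (LinearMap.id.prodMap V.subtype)).codRestrict _
      fun p => traceWord_mem_bchCode hβ hδn hθ hδmod _
  have hf : Function.Injective f := by
    rw [← LinearMap.ker_eq_bot, LinearMap.ker_eq_bot']
    rintro ⟨a, b, hb⟩ hab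
    obtain ⟨rfl, rfl⟩ := hinj a b hb (congrArg Subtype.val hab)
    rfl
  -- The values at 1 and at β^δ inject the code into `ZMod 3 × V`. Then the injection `f` in the
  -- other direction is bijective by counting.
  let g : bchCode (ZMod 3) n β δ → ZMod 3 × V :=
    fun c => (∑ t, c.1 t, ⟨spectrumAt β c.1 δ, hV c.1 c.2⟩)
  have hg : Function.Injective g := by
    rintro ⟨c, hc⟩ ⟨d, hd⟩ hcd
    obtain ⟨h1, h2⟩ := Prod.ext_iff.1 hcd
    have h2' : spectrumAt β c δ = spectrumAt β d δ := congrArg Subtype.val h2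
    have := eq_zero_of_mem_bchCode hn hm hβ hδ (sub_mem hc hd)
      (by simpa [sub_eq_zero] using h1) (by rw [spectrumAt_sub, h2', sub_self])
    exact Subtype.ext (sub_eq_zero.1 this)
  exact ⟨LinearEquiv.ofBijective f
    (hf.bijective_of_nat_card_le (Nat.card_le_card_of_injective g hg)), fun _ _ => rfl⟩

end Spectrum

/-! ### Counting values, and quadratic functions over GF(3). -/

section Counting

theorem three_mul_card_fiber {G : Type*} [AddCommGroup G] [Fintype G] {φ : G →+ ZMod 3}
    (hφ : φ ≠ 0) (c : ZMod 3) : 3 * (Finset.univ.filter fun g => φ g = c).card = Fintype.card G := by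
  have : Fact (Nat.Prime 3) := ⟨Nat.prime_three⟩
  obtain ⟨g, hg⟩ := DFunLike.ne_iff.1 hφ
  have hsurj : Function.Surjective φ := fun d => ⟨(d * (φ g)⁻¹).val • g, by
    rw [map_nsmul, nsmul_eq_mul, ZMod.natCast_zmod_val, inv_mul_cancel_right₀ hg]⟩
  rw [← Finset.card_univ (α := G), Finset.card_eq_sum_card_fiberwise (s := (Finset.univ : Finset G))
    (f := φ) (t := Finset.univ) (fun _ _ => Finset.mem_coe.2 (Finset.mem_univ _)),
    Finset.sum_congr rfl fun d _ => AddMonoidHom.card_fiber_eq_of_mem_range φ (hsurj d) (hsurj c)]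
  simp [ZMod.card]

theorem hammingNorm_add_count (n : ℕ) (f : ℕ → ZMod 3) :
    hammingNorm (fun t : Fin n => f t) + Nat.count (fun t => f t = 0) n = n := by
  have h : Nat.count (fun t => f t = 0) n = (Finset.univ.filter fun t : Fin n => f t = 0).card := by
    rw [Nat.count_eq_card_filter_range, Finset.card_filter, Finset.card_filter,
      Fin.sum_univ_eq_sum_range (fun t => if f t = 0 then 1 else 0)]
  rw [h, hammingNorm, add_comm, Finset.card_filter_add_card_filter_not, Finset.card_fin]

theorem count_mul_of_periodic {p : ℕ → Prop} [DecidablePred p] {P : ℕ}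
    (hp : ∀ t, p (P + t) ↔ p t) (k : ℕ) : Nat.count p (k * P) = k * Nat.count p P := by
  induction k with
  | zero => simp
  | succ k ih =>
    rw [add_mul, one_mul, add_comm, Nat.count_add]
    simp only [hp, ih]
    ring

theorem count_pow_eq_card {F : Type*} [Field F] [DecidableEq F] {γ : F} {N : ℕ}
    (hγ : IsPrimitiveRoot γ N) (hN : 0 < N) {S : Finset F} (hS : ∀ y, y ∈ S ↔ ∃ t : ℕ, γ ^ t = y)
    (p : F → Prop) [DecidablePred p] : Nat.count (fun t => p (γ ^ t)) N = (S.filter p).card := by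
  rw [Nat.count_eq_card_filter_range]
  refine Finset.card_nbij (fun t => γ ^ t) ?_ ?_ ?_
  · intro t ht
    simp only [Finset.coe_filter, Finset.mem_range, Set.mem_ofPred_eq] at ht ⊢
    exact ⟨(hS _).2 ⟨t, rfl⟩, ht.2⟩
  · intro s hs t ht hst
    simp only [Finset.coe_filter, Finset.mem_range, Set.mem_ofPred_eq] at hs ht
    exact hγ.pow_inj hs.1 ht.1 hst
  · intro y hy
    simp only [Finset.coe_filter, Set.mem_ofPred_eq] at hy
    obtain ⟨t, ht⟩ := (hS y).1 hy.1
    have h1 : γ ^ (t % N) = y := by rw [← pow_eq_pow_mod t hγ.pow_eq_one, ht]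
    refine ⟨t % N, ?_, h1⟩
    simp only [Finset.coe_filter, Finset.mem_range, Set.mem_ofPred_eq]
    exact ⟨Nat.mod_lt _ hN, h1 ▸ hy.2⟩

/-- The form is an Eisenstein norm, and 3 ramifies, so only unit multiples of 3^h occur. Descent:
the form is (y-z)² modulo 3, hence 3 ∣ y - z; divisibility by 9 then gives 3 ∣ z, and y, z can be
divided by 3. -/
theorem eq_of_sq_add_mul_add_sq_eq (h : ℕ) : ∀ y z : ℤ, y ^ 2 + y * z + z ^ 2 = (3 ^ h) ^ 2 →
    y = 0 ∨ z = 0 ∨ (y = 3 ^ h ∧ z = -3 ^ h) ∨ (y = -3 ^ h ∧ z = 3 ^ h) := by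
  induction h with
  | zero =>
    intro y z hyz
    have h1 : y ≤ 1 := by nlinarith [sq_nonneg (y + 2 * z)]
    have h2 : -1 ≤ y := by nlinarith [sq_nonneg (y + 2 * z)]
    have h3 : z ≤ 1 := by nlinarith [sq_nonneg (z + 2 * y)]
    have h4 : -1 ≤ z := by nlinarith [sq_nonneg (z + 2 * y)]
    interval_cases y <;> interval_cases z <;> simp_all
  | succ h ih =>
    intro y z hyz
    have p3 : Prime (3 : ℤ) := Int.prime_three
    have e1 : y ^ 2 + y * z + z ^ 2 = 9 * (3 ^ h) ^ 2 := by rw [hyz]; ring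
    obtain ⟨d, hd⟩ : (3 : ℤ) ∣ y - z :=
      p3.dvd_of_dvd_pow (n := 2) ⟨3 * (3 ^ h) ^ 2 - y * z, by linarith⟩
    obtain ⟨w, rfl⟩ : (3 : ℤ) ∣ z := by
      have : (3 : ℤ) ∣ z ^ 2 := ⟨(3 ^ h) ^ 2 - d * z - d ^ 2, by
        have : y = z + 3 * d := by linarith
        subst this; linarith⟩
      exact p3.dvd_of_dvd_pow this
    obtain rfl : y = 3 * (d + w) := by linarith
    rcases ih (d + w) w (by linarith) with h1 | h1 | ⟨h1, h2⟩ | ⟨h1, h2⟩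
    · left; rw [h1, mul_zero]
    · right; left; rw [h1, mul_zero]
    · right; right; left; rw [h1, h2]; constructor <;> ring
    · right; right; right; rw [h1, h2]; constructor <;> ring

/-- The value distribution of a nondegenerate quadratic function in odd dimension over `GF(3)`. -/
theorem card_fiber_of_quadratic {G : Type*} [AddCommGroup G] [Fintype G] {h : ℕ}
    (hG : Fintype.card G = 3 ^ (2 * h + 1)) (Q : G → ZMod 3) (B : G → G →+ ZMod 3)
    (hQB : ∀ u y, Q (u + y) = Q u + Q y + B u y) (hB : ∀ u, u ≠ 0 → B u ≠ 0)
    {A : ZMod 3 → ℕ} (hA : ∀ c, A c = (Finset.univ.filter fun x => Q x = c).card)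
    (h1 : Even (A 1)) (h2 : Even (A 2)) :
    A 0 = 3 ^ (2 * h) ∧ ((A 1 = 3 ^ (2 * h) + 3 ^ h ∧ A 2 + 3 ^ h = 3 ^ (2 * h)) ∨
      (A 2 = 3 ^ (2 * h) + 3 ^ h ∧ A 1 + 3 ^ h = 3 ^ (2 * h))) := by
  classical
  have hQ0 : Q 0 = 0 := by
    have := hQB 0 0
    rw [map_zero, add_zero, add_zero] at this
    simpa using this
  have hB0 : ∀ y, B 0 y = 0 := fun y => by
    have := hQB 0 y
    rw [zero_add, hQ0, zero_add] at this
    simpa using this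
  have huniv : (Finset.univ : Finset (ZMod 3)) = {0, 1, 2} := by decide
  have hsum : A 0 + A 1 + A 2 = 3 ^ (2 * h + 1) := by
    rw [← hG, ← Finset.card_univ, Finset.card_eq_sum_card_fiberwise (f := Q) (t := Finset.univ)
      (fun _ _ => Finset.mem_coe.2 (Finset.mem_univ _)), huniv]
    rw [Finset.sum_insert (by decide), Finset.sum_pair (by decide), hA, hA, hA]
    ring
  -- the number of pairs `(x, y)` with `Q x = Q y + d`
  have hS : ∀ d, ∑ y, (Finset.univ.filter fun x => Q x = Q y + d).card = ∑ c, A c * A (c + d) := by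
    intro d
    simp only [← hA]
    rw [← Finset.sum_fiberwise (s := Finset.univ) (g := Q)]
    refine Finset.sum_congr rfl fun c _ => ?_
    rw [Finset.sum_congr rfl fun y hy => by rw [(Finset.mem_filter.1 hy).2], Finset.sum_const,
      smul_eq_mul, hA c]
  -- Substituting x = u + y turns Q x = Q y + d into B u y = d - Q u, which is linear in y.
  have hS' : ∀ d, ∑ y, (Finset.univ.filter fun x => Q x = Q y + d).card =
      ∑ u, (Finset.univ.filter fun y => B u y = d - Q u).card := by
    intro d
    simp only [Finset.card_filter]
    rw [Finset.sum_comm (s := (Finset.univ : Finset G)) (t := (Finset.univ : Finset G))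
      (f := fun u y => if B u y = d - Q u then 1 else 0)]
    refine Finset.sum_congr rfl fun y _ => ?_
    rw [← Equiv.sum_comp (Equiv.addRight y)]
    refine Finset.sum_congr rfl fun u _ => ?_
    simp only [Equiv.coe_addRight, hQB]
    congr 1
    apply propext
    constructor <;> intro H <;> linear_combination H
  -- For u ≠ 0 a third of all y qualify. For u = 0 it is all of them or none, according to whether d
  -- = 0.
  have hS3 : ∀ d, 3 * ∑ y, (Finset.univ.filter fun x => Q x = Q y + d).card =
      3 * (if d = 0 then 3 ^ (2 * h + 1) else 0) + (3 ^ (2 * h + 1) - 1) * 3 ^ (2 * h + 1) := by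
    intro d
    rw [hS', ← Finset.add_sum_erase _ _ (Finset.mem_univ 0), mul_add, Finset.mul_sum,
      Finset.sum_congr rfl fun u hu => three_mul_card_fiber (hB u (Finset.ne_of_mem_erase hu)) _,
      Finset.sum_const, Finset.card_erase_of_mem (Finset.mem_univ _), Finset.card_univ, hG,
      smul_eq_mul]
    simp only [hB0, hQ0, sub_zero, eq_comm (a := (0 : ZMod 3))]
    split_ifs with hd
    · rw [Finset.filter_true_of_mem (fun _ _ => hd), Finset.card_univ, hG]
    · rw [Finset.filter_false_of_mem (fun _ _ => hd), Finset.card_empty]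
  have e0 := hS3 0
  have e1 := hS3 1
  have t1 : (2 : ZMod 3) + 1 = 0 := by decide
  have t2 : (1 : ZMod 3) + 1 = 2 := by decide
  rw [hS, huniv, Finset.sum_insert (by decide), Finset.sum_pair (by decide), if_pos rfl] at e0
  rw [hS, huniv, Finset.sum_insert (by decide), Finset.sum_pair (by decide),
    if_neg (by decide)] at e1
  simp only [add_zero, zero_add, t1, t2, mul_zero] at e0 e1
  -- Subtracting the cases d = 0 and d = 1 gives the squared modulus of the Gauss sum of Q.
  have hdiff : A 0 * A 0 + A 1 * A 1 + A 2 * A 2 =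
      3 ^ (2 * h + 1) + (A 0 * A 1 + A 1 * A 2 + A 2 * A 0) := by omega
  obtain ⟨s, hs⟩ : ∃ s, 3 ^ h = s := ⟨_, rfl⟩
  have hs2 : 3 ^ (2 * h) = s ^ 2 := by rw [mul_comm, pow_mul, hs]
  have hs3 : 3 ^ (2 * h + 1) = 3 * s ^ 2 := by rw [pow_succ, hs2, mul_comm]
  have hodd : ¬ Even (s ^ 2) :=
    Nat.not_even_iff_odd.2 ((hs ▸ Odd.pow (by decide) : Odd s).pow)
  rw [hs3] at hsum hdiff
  rw [hs2, hs]
  have key := eq_of_sq_add_mul_add_sq_eq h (A 1 - s ^ 2) (A 2 - s ^ 2) (by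
    have hsz : (3 : ℤ) ^ h = s := by exact_mod_cast hs
    rw [hsz]
    zify at hsum hdiff
    have hA0 : (A 0 : ℤ) = 3 * s ^ 2 - A 1 - A 2 := by linarith
    rw [hA0] at hdiff
    linarith)
  rw [show (3 : ℤ) ^ h = s by exact_mod_cast hs] at key
  -- The first two cases would make A 1 or A 2 equal to the odd number s².
  rcases key with k | k | ⟨k, k'⟩ | ⟨k, k'⟩
  · have : A 1 = s ^ 2 := by zify; linarith
    exact absurd (this ▸ h1) hodd
  · have : A 2 = s ^ 2 := by zify; linarith
    exact absurd (this ▸ h2) hodd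
  · have a1 : A 1 = s ^ 2 + s := by zify; linarith
    have a2 : A 2 + s = s ^ 2 := by zify; linarith
    exact ⟨by omega, Or.inl ⟨a1, a2⟩⟩
  · have a1 : A 2 = s ^ 2 + s := by zify; linarith
    have a2 : A 1 + s = s ^ 2 := by zify; linarith
    exact ⟨by omega, Or.inr ⟨a1, a2⟩⟩

end Counting

/-! ### The quadratic functions Tr(b x^(3^k+1)). -/

section Trace

variable {F : Type*} [Field F] [Algebra (ZMod 3) F]

theorem trace_pow_three_pow [Finite F] (x : F) (e : ℕ) :
    Algebra.trace (ZMod 3) F (x ^ 3 ^ e) = Algebra.trace (ZMod 3) F x := by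
  have : Fact (Nat.Prime 3) := ⟨Nat.prime_three⟩
  induction e with
  | zero => simp
  | succ e ih =>
    rw [pow_succ, pow_mul, ← ih]
    have := Algebra.trace_eq_of_algEquiv (FiniteField.frobeniusAlgEquivOfAlgebraic (ZMod 3) F)
      (x ^ 3 ^ e)
    simpa [ZMod.card] using this

theorem exists_trace_mul_ne_zero [Finite F] {a : F} (ha : a ≠ 0) :
    ∃ y, Algebra.trace (ZMod 3) F (a * y) ≠ 0 := by
  have : Fact (Nat.Prime 3) := ⟨Nat.prime_three⟩
  have htr := (traceForm_nondegenerate (ZMod 3) F).1 a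
  simp_rw [Algebra.traceForm_apply] at htr
  by_contra! hf
  exact ha (htr hf)

/-- The polarization of `x ↦ Tr (b x ^ (3 ^ k + 1))`. -/
noncomputable def polarTrace (b : F) (k : ℕ) (u : F) : F →+ ZMod 3 :=
  AddMonoidHom.mk' (fun y => Algebra.trace (ZMod 3) F (b * (u ^ 3 ^ k * y + u * y ^ 3 ^ k)))
    fun x y => by
      have : CharP F 3 := charP_of_injective_algebraMap (algebraMap (ZMod 3) F).injective 3
      have : Fact (Nat.Prime 3) := ⟨Nat.prime_three⟩
      rw [add_pow_char_pow, ← map_add]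
      congr 1
      ring

theorem polarTrace_spec (b : F) (k : ℕ) (u y : F) :
    Algebra.trace (ZMod 3) F (b * (u + y) ^ (3 ^ k + 1)) =
      Algebra.trace (ZMod 3) F (b * u ^ (3 ^ k + 1)) +
      Algebra.trace (ZMod 3) F (b * y ^ (3 ^ k + 1)) + polarTrace b k u y := by
  have : CharP F 3 := charP_of_injective_algebraMap (algebraMap (ZMod 3) F).injective 3
  have : Fact (Nat.Prime 3) := ⟨Nat.prime_three⟩
  rw [polarTrace, AddMonoidHom.mk'_apply, ← map_add, ← map_add, pow_succ, add_pow_char_pow]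
  congr 1
  ring

/-- A nonzero u in the radical would make -1 a square in F, impossible because 3^(2h+1) ≡ 3 modulo
4. -/
theorem polarTrace_ne_zero [Finite F] {h : ℕ} (hF : Nat.card F = 3 ^ (2 * h + 1)) {b u : F} (hb : b ≠ 0)
    (hu : u ≠ 0) : polarTrace b (h + 1) u ≠ 0 := by
  have := Fintype.ofFinite F
  have : CharP F 3 := charP_of_injective_algebraMap (algebraMap (ZMod 3) F).injective 3
  have : Fact (Nat.Prime 3) := ⟨Nat.prime_three⟩
  rw [Nat.card_eq_fintype_card] at hF
  intro h0
  -- Applying the 3^h-Frobenius inside the trace turns y^(3^(h+1)) into y^(3^(2h+1)) = y, so the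
  -- polarization becomes Tr of this coefficient times y.
  have hz : b * u ^ 3 ^ (h + 1) + (b * u) ^ 3 ^ h = 0 := by
    by_contra hne
    obtain ⟨y, hy⟩ := exists_trace_mul_ne_zero hne
    apply hy
    have h1 : polarTrace b (h + 1) u y = 0 := by rw [h0]; rfl
    rw [← h1, polarTrace, AddMonoidHom.mk'_apply, add_mul, map_add, mul_add, map_add, mul_assoc,
      ← mul_assoc b u, ← trace_pow_three_pow (b * u * y ^ 3 ^ (h + 1)) h, mul_pow _ (y ^ _),
      ← pow_mul, ← pow_add, show h + 1 + h = 2 * h + 1 by ring, ← hF, FiniteField.pow_card]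
  -- With w = u^(3^h) and 3^h = 2r + 1, the relation reads b w (w² + (b^r)²) = 0.
  have hsq : IsSquare (-1 : F) := by
    obtain ⟨r, hr⟩ : Odd (3 ^ h) := Odd.pow (by decide)
    have hbr : b ^ r ≠ 0 := pow_ne_zero _ hb
    have hw : u ^ 3 ^ h ≠ 0 := pow_ne_zero _ hu
    have e1 : b * u ^ 3 ^ h * ((u ^ 3 ^ h) ^ 2 + (b ^ r) ^ 2) = 0 := by
      rw [← hz, pow_succ 3 h, pow_mul, mul_pow b u]
      have : b ^ 3 ^ h = b * (b ^ r) ^ 2 := by rw [hr]; ring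
      rw [this]
      ring
    have e2 := (mul_eq_zero.1 e1).resolve_left (mul_ne_zero hb hw)
    refine ⟨u ^ 3 ^ h / b ^ r, ?_⟩
    field_simp
    linear_combination -e2
  rw [FiniteField.isSquare_neg_one_iff, hF] at hsq
  apply hsq
  rw [pow_succ, pow_mul, Nat.mul_mod, Nat.pow_mod]
  simp

end Trace

/-! ### Weights of the trace words. -/

section Weights

variable {F : Type*} [Field F] [Algebra (ZMod 3) F] {n h : ℕ} {g : F}

theorem hammingNorm_traceWord_zero {θ : F} {a : ZMod 3} (ha : a ≠ 0) :
    hammingNorm (traceWord n θ (a, 0)) = n := by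
  have : ∀ t : Fin n, traceWord n θ (a, 0) t = a := fun t => by simp [traceWord_apply]
  simp [hammingNorm, this, ha]

theorem hammingNorm_traceWord_add_count (θ : F) (a : ZMod 3) (b : F) :
    hammingNorm (traceWord n θ (a, b)) +
      Nat.count (fun t => Algebra.trace (ZMod 3) F (b * θ ^ t) = -a) n = n := by
  have H := hammingNorm_add_count n fun t => a + Algebra.trace (ZMod 3) F (b * θ ^ t)
  simp only [add_eq_zero_iff_neg_eq, eq_comm (a := -a)] at H
  exact H

/-- The positions t < n meet each pair ±x of nonzero elements once. As Q is even, zeros of the word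
are half the solutions x ≠ 0 of Q x = -a. -/
theorem hammingNorm_traceWord_of_odd [Finite F] (hn : 2 * n + 1 = 3 ^ (2 * h + 1))
    (hF : Nat.card F = 3 ^ (2 * h + 1)) (hg : IsPrimitiveRoot g (2 * n)) {b : F} (hb : b ≠ 0)
    {W : ZMod 3 → ℕ} (hW : ∀ a, W a = hammingNorm (traceWord n (g ^ (3 ^ (h + 1) + 1)) (a, b))) :
    W 0 = 3 ^ (2 * h) ∧
      ((2 * W 1 + 3 ^ h + 1 = 2 * 3 ^ (2 * h) ∧ 2 * W 2 + 1 = 2 * 3 ^ (2 * h) + 3 ^ h) ∨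
       (2 * W 2 + 3 ^ h + 1 = 2 * 3 ^ (2 * h) ∧ 2 * W 1 + 1 = 2 * 3 ^ (2 * h) + 3 ^ h)) := by
  classical
  have := Fintype.ofFinite F
  have hcard : Fintype.card F = 3 ^ (2 * h + 1) := by rw [← hF, Nat.card_eq_fintype_card]
  have hn0 : 0 < n := by
    have : 3 ^ 1 ≤ 3 ^ (2 * h + 1) := Nat.pow_le_pow_right (by norm_num) (by omega)
    omega
  let Q : F → ZMod 3 := fun x => Algebra.trace (ZMod 3) F (b * x ^ (3 ^ (h + 1) + 1))
  have hQ : ∀ t : ℕ, Algebra.trace (ZMod 3) F (b * (g ^ (3 ^ (h + 1) + 1)) ^ t) = Q (g ^ t) :=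
    fun t => by simp only [Q]; rw [← pow_mul, ← pow_mul, mul_comm t]
  have hQ0 : Q 0 = 0 := by simp [Q]
  let A : ZMod 3 → ℕ := fun c => (Finset.univ.filter fun x => Q x = c).card
  let N : ZMod 3 → ℕ := fun c => Nat.count (fun t => Q (g ^ t) = c) n
  have hgn : g ^ n = -1 := by
    have h1 : (g ^ n) ^ 2 = 1 := by rw [← pow_mul, mul_comm, hg.pow_eq_one]
    exact (mul_self_eq_one_iff.1 ((sq _).symm.trans h1)).resolve_left
      (hg.pow_ne_one_of_pos_of_lt hn0.ne' (by omega))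
  -- The summand for c = 0 is x = 0. The factor 2 comes from g^n = -1 and the even exponent 3^(h+1)
  -- + 1; it also supplies the parity needed by `card_fiber_of_quadratic`.
  have hAN : ∀ c, A c = (if c = 0 then 1 else 0) + 2 * N c := by
    intro c
    have hper : ∀ t, Q (g ^ (n + t)) = c ↔ Q (g ^ t) = c := by
      intro t
      have : Even (3 ^ (h + 1) + 1) := by
        rw [Nat.even_add_one, Nat.not_even_iff_odd]; exact Odd.pow (by decide)
      simp only [Q, pow_add g n, hgn, neg_one_mul, this.neg_pow]
    have hS : ∀ y, y ∈ (Finset.univ.erase (0 : F)) ↔ ∃ t : ℕ, g ^ t = y := by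
      intro y
      rw [Finset.mem_erase]
      constructor
      · rintro ⟨hy, -⟩
        have : NeZero (2 * n) := ⟨by omega⟩
        obtain ⟨i, -, hi⟩ := hg.eq_pow_of_pow_eq_one (ξ := y) (by
          rw [show 2 * n = Fintype.card F - 1 by omega]
          exact FiniteField.pow_card_sub_one_eq_one y hy)
        exact ⟨i, hi⟩
      · rintro ⟨t, rfl⟩
        exact ⟨pow_ne_zero _ (hg.ne_zero (by omega)), Finset.mem_univ _⟩
    have h2 : 2 * N c = ((Finset.univ.erase (0 : F)).filter fun x => Q x = c).card := by
      rw [← count_pow_eq_card hg (by omega) hS (fun x => Q x = c), count_mul_of_periodic hper]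
    rw [h2, Finset.filter_erase]
    split_ifs with hc
    · have : (0 : F) ∈ Finset.univ.filter fun x => Q x = c := by simp [hQ0, hc]
      rw [add_comm]
      exact (Finset.card_erase_add_one this).symm
    · rw [Finset.erase_eq_of_notMem (by simp [hQ0, eq_comm, hc]), zero_add]
  have hW' : ∀ a, W a + N (-a) = n := fun a => by
    have := hammingNorm_traceWord_add_count (n := n) (g ^ (3 ^ (h + 1) + 1)) a b
    simpa only [hQ, ← hW] using this
  have a0 := hAN 0
  have a1 := hAN 1
  have a2 := hAN 2
  rw [if_pos rfl] at a0
  rw [if_neg (by decide), zero_add] at a1 a2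
  have key := card_fiber_of_quadratic hcard Q (polarTrace b (h + 1))
    (polarTrace_spec b (h + 1)) (fun u hu => polarTrace_ne_zero hF hb hu) (A := A) (fun _ => rfl)
    (a1 ▸ even_two_mul _) (a2 ▸ even_two_mul _)
  have w0 := hW' 0
  have w1 := hW' 1
  have w2 := hW' 2
  rw [neg_zero] at w0
  rw [show -(1 : ZMod 3) = 2 by decide] at w1
  rw [show -(2 : ZMod 3) = 1 by decide] at w2
  rw [pow_succ] at hn
  omega

/-! ### The subfield GF(3^l) and the weights for m = 2l. -/

/-- The `3 ^ l`-element subfield, as a subspace over `GF(3)`. -/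
def frobeniusFixed (F : Type*) [Field F] [Algebra (ZMod 3) F] (l : ℕ) : Submodule (ZMod 3) F where
  carrier := {y | y ^ 3 ^ l = y}
  zero_mem' := zero_pow (by positivity)
  add_mem' {x y} hx hy := by
    have : CharP F 3 := charP_of_injective_algebraMap (algebraMap (ZMod 3) F).injective 3
    have : Fact (Nat.Prime 3) := ⟨Nat.prime_three⟩
    change (x + y) ^ 3 ^ l = x + y
    rw [add_pow_char_pow, show x ^ 3 ^ l = x from hx, show y ^ 3 ^ l = y from hy]
  smul_mem' r x hx := by
    have : Fact (Nat.Prime 3) := ⟨Nat.prime_three⟩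
    change (r • x) ^ 3 ^ l = r • x
    rw [_root_.smul_pow, ZMod.pow_card_pow, show x ^ 3 ^ l = x from hx]

theorem mem_frobeniusFixed {l : ℕ} {y : F} : y ∈ frobeniusFixed F l ↔ y ^ 3 ^ l = y := Iff.rfl

theorem mem_frobeniusFixed_iff_exists_pow {l : ℕ} (hl : 0 < l) {γ y : F}
    (hγ : IsPrimitiveRoot γ (3 ^ l - 1)) :
    y ∈ frobeniusFixed F l ∧ y ≠ 0 ↔ ∃ t : ℕ, γ ^ t = y := by
  have h3 : 3 ^ 1 ≤ 3 ^ l := Nat.pow_le_pow_right (by norm_num) hl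
  have h1 : 3 ^ l - 1 + 1 = 3 ^ l := by omega
  rw [mem_frobeniusFixed]
  constructor
  · rintro ⟨hy, hy0⟩
    have : NeZero (3 ^ l - 1) := ⟨by omega⟩
    obtain ⟨i, -, hi⟩ := hγ.eq_pow_of_pow_eq_one (ξ := y) (by
      apply mul_right_cancel₀ hy0
      rw [← pow_succ, h1, hy, one_mul])
    exact ⟨i, hi⟩
  · rintro ⟨t, rfl⟩
    refine ⟨?_, pow_ne_zero _ (hγ.ne_zero (by omega))⟩
    rw [← h1, pow_succ, ← pow_mul, mul_comm t, pow_mul, hγ.pow_eq_one, one_pow, one_mul]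

theorem count_pow_add_eq_card_frobeniusFixed [Finite F] {l : ℕ} (hl : 0 < l) {γ : F}
    (hγ : IsPrimitiveRoot γ (3 ^ l - 1)) (p : F → Prop) [DecidablePred p] :
    Nat.count (fun t => p (γ ^ t)) (3 ^ l - 1) + (if p 0 then 1 else 0) =
      Nat.card {y : frobeniusFixed F l // p y} := by
  classical
  have := Fintype.ofFinite F
  have h3 : 3 ^ 1 ≤ 3 ^ l := Nat.pow_le_pow_right (by norm_num) hl
  let S : Finset F := (Finset.univ.filter fun y => y ∈ frobeniusFixed F l).erase 0
  have hS : ∀ y, y ∈ S ↔ ∃ t : ℕ, γ ^ t = y := fun y => by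
    rw [← mem_frobeniusFixed_iff_exists_pow hl hγ]
    simp [S, and_comm]
  rw [count_pow_eq_card hγ (by omega) hS p]
  have e1 : Nat.card {y : frobeniusFixed F l // p y} =
      ((Finset.univ.filter fun y => y ∈ frobeniusFixed F l).filter p).card := by
    rw [Finset.filter_filter, ← Fintype.card_subtype, ← Nat.card_eq_fintype_card]
    exact Nat.card_congr (Equiv.subtypeSubtypeEquivSubtypeInter _ _)
  rw [e1, Finset.filter_erase]
  split_ifs with h0
  · exact Finset.card_erase_add_one (by simp [h0])
  · rw [Finset.erase_eq_of_notMem (by simp [h0]), add_zero]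

theorem card_frobeniusFixed [Finite F] {l : ℕ} (hl : 0 < l) {γ : F} (hγ : IsPrimitiveRoot γ (3 ^ l - 1)) :
    Nat.card (frobeniusFixed F l) = 3 ^ l := by
  have h3 : 3 ^ 1 ≤ 3 ^ l := Nat.pow_le_pow_right (by norm_num) hl
  have h := count_pow_add_eq_card_frobeniusFixed hl hγ fun _ => True
  rw [Nat.card_congr (Equiv.subtypeUnivEquiv fun _ => trivial), if_pos trivial] at h
  rw [← h, Nat.count_true]
  omega

/-- The word runs (3^l+1)/2 times through the values of y ↦ a + Tr(b y) on the nonzero elements of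
the subfield. A nonzero functional takes each value on a third of the subfield; y = 0 must be
discounted when a = 0. -/
theorem hammingNorm_traceWord_of_even [Finite F] {l : ℕ} (hl : 0 < l) (hn : 2 * n + 1 = 3 ^ (2 * l))
    (hF : Nat.card F = 3 ^ (2 * l)) {γ : F} (hγ : IsPrimitiveRoot γ (3 ^ l - 1)) {b : F}
    (hb : b ≠ 0) (hbK : b ∈ frobeniusFixed F l) (a : ZMod 3) :
    2 * hammingNorm (traceWord n γ (a, b)) + (if a = 0 then 0 else 3 ^ l + 1) =
      2 * (3 ^ (2 * l - 1) + 3 ^ (l - 1)) := by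
  classical
  have := Fintype.ofFinite F
  let φ : frobeniusFixed F l →+ ZMod 3 :=
    ((Algebra.trace (ZMod 3) F).comp ((LinearMap.mulLeft (ZMod 3) b).comp
      (frobeniusFixed F l).subtype)).toAddMonoidHom
  -- If Tr(b x) ≠ 0, then x^(3^l) + x lies in the subfield and the functional takes the value 2 Tr(b
  -- x) ≠ 0 there.
  have hφ : φ ≠ 0 := by
    obtain ⟨x, hx⟩ := exists_trace_mul_ne_zero hb
    intro h0
    have hx2 : (x ^ 3 ^ l) ^ 3 ^ l = x := by
      rw [← pow_mul, ← pow_add, ← two_mul, ← hF, Nat.card_eq_fintype_card, FiniteField.pow_card]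
    have hK : x ^ 3 ^ l + x ∈ frobeniusFixed F l := by
      have : CharP F 3 := charP_of_injective_algebraMap (algebraMap (ZMod 3) F).injective 3
      have : Fact (Nat.Prime 3) := ⟨Nat.prime_three⟩
      rw [mem_frobeniusFixed, add_pow_char_pow, hx2, add_comm]
    have h1 : Algebra.trace (ZMod 3) F (b * (x ^ 3 ^ l + x)) = 0 := DFunLike.congr_fun h0 ⟨_, hK⟩
    have h2 : Algebra.trace (ZMod 3) F (b * x ^ 3 ^ l) = Algebra.trace (ZMod 3) F (b * x) := by
      rw [← trace_pow_three_pow (b * x) l, mul_pow, mem_frobeniusFixed.1 hbK]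
    rw [mul_add, map_add, h2] at h1
    generalize Algebra.trace (ZMod 3) F (b * x) = z at h1 hx
    revert z
    decide
  have hN : 3 * (Nat.count (fun t => Algebra.trace (ZMod 3) F (b * γ ^ t) = -a) (3 ^ l - 1) +
      if a = 0 then 1 else 0) = 3 ^ l := by
    have h1 := count_pow_add_eq_card_frobeniusFixed hl hγ
      fun y => Algebra.trace (ZMod 3) F (b * y) = -a
    have h2 := three_mul_card_fiber hφ (-a)
    rw [← Fintype.card_subtype, ← Nat.card_eq_fintype_card, ← Nat.card_eq_fintype_card,
      card_frobeniusFixed hl hγ] at h2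
    simp only [mul_zero, map_zero, zero_eq_neg] at h1
    rw [h1]
    exact h2
  obtain ⟨k, hk⟩ : Even (3 ^ l + 1) := by
    rw [Nat.even_add_one, Nat.not_even_iff_odd]; exact Odd.pow (by decide)
  have hper : ∀ t, Algebra.trace (ZMod 3) F (b * γ ^ (3 ^ l - 1 + t)) = -a ↔
      Algebra.trace (ZMod 3) F (b * γ ^ t) = -a := fun t => by
    rw [pow_add, hγ.pow_eq_one, one_mul]
  obtain ⟨q, hq⟩ : ∃ q, 3 ^ (l - 1) = q := ⟨_, rfl⟩
  have hq3 : 3 ^ l = 3 * q := by rw [← hq, ← pow_succ']; congr 1; omega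
  have hq9 : 3 ^ (2 * l - 1) = 3 * q ^ 2 := by
    rw [← hq, ← pow_mul, ← pow_succ']; congr 1; omega
  have hq27 : 3 ^ (2 * l) = 9 * q ^ 2 := by rw [mul_comm, pow_mul, hq3]; ring
  have hq0 : 0 < q := by rw [← hq]; positivity
  have hnk : n = k * (3 ^ l - 1) := by
    have : 2 * n = 2 * (k * (3 ^ l - 1)) := by
      rw [← mul_assoc, two_mul k, ← hk, ← Nat.sq_sub_sq (3 ^ l) 1, ← pow_mul, mul_comm l, ← hn]
      simp
    omega
  have hW := hammingNorm_traceWord_add_count (n := n) γ a b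
  rw [hnk, count_mul_of_periodic hper, ← hnk] at hW
  rw [hq9, hq, hq3]
  rw [hq3] at hN hk
  rw [hq27] at hn
  obtain ⟨N, hNe⟩ : ∃ N, Nat.count (fun t => Algebra.trace (ZMod 3) F (b * γ ^ t) = -a)
    (3 ^ l - 1) = N := ⟨_, rfl⟩
  rw [hq3] at hNe
  rw [hq3, hNe] at hW
  rw [hNe] at hN
  split_ifs at hN ⊢ with ha
  · obtain rfl : q = N + 1 := by omega
    nlinarith
  · obtain rfl : q = N := by omega
    nlinarith

end Weights

/-! ### From weights of parametrized words to weight distributions. -/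

section Distribution

theorem isMinDistance_of_isLeast {K : Type*} [Field K] [DecidableEq K] {n : ℕ}
    {C : Submodule K (Fin n → K)} {d : ℕ} (h : IsLeast (nonzeroWeights C) d) :
    IsMinDistance C d := by
  obtain ⟨⟨c, hc, hc0, hcd⟩, hle⟩ := h
  refine ⟨⟨c, hc, 0, C.zero_mem, hc0, by rw [hammingDist_zero_right, hcd]⟩, ?_⟩
  rintro _ ⟨c, hc, c', hc', hne, rfl⟩
  exact hle ⟨-c + c', C.add_mem (C.neg_mem hc) hc', fun h => hne (neg_add_eq_zero.1 h),
    (hammingDist_eq_hammingNorm c c').symm⟩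

variable {V : Type*} [AddCommGroup V] [Module (ZMod 3) V] {n : ℕ}
  {C : Submodule (ZMod 3) (Fin n → ZMod 3)} (e : (ZMod 3 × V) ≃ₗ[ZMod 3] C)

theorem weightFrequency_eq_ncard (w : ℕ) :
    weightFrequency C w = {p | hammingNorm (e p : Fin n → ZMod 3) = w}.ncard := by
  rw [weightFrequency, ← Set.ncard_image_of_injective (f := fun p => (e p : Fin n → ZMod 3)) _
    (Subtype.val_injective.comp e.injective)]
  congr 1
  ext c
  constructor
  · rintro ⟨hc, hw⟩
    exact ⟨e.symm ⟨c, hc⟩, by simpa using (Nat.cast_injective hw), by simp⟩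
  · rintro ⟨p, hp, rfl⟩
    exact ⟨(e p).2, by exact_mod_cast hp⟩

theorem hammingNorm_equiv_eq_zero_iff (p : ZMod 3 × V) :
    hammingNorm (e p : Fin n → ZMod 3) = 0 ↔ p = 0 := by
  simp

theorem nonzeroWeights_eq :
    nonzeroWeights C = {w | ∃ p, p ≠ 0 ∧ hammingNorm (e p : Fin n → ZMod 3) = w} := by
  ext w
  constructor
  · rintro ⟨c, hc, hc0, hw⟩
    refine ⟨e.symm ⟨c, hc⟩, ?_, by simpa using hw⟩
    rw [Ne, e.symm.map_eq_zero_iff]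
    exact fun h => hc0 (congrArg Subtype.val h)
  · rintro ⟨p, hp, rfl⟩
    exact ⟨e p, (e p).2, by simpa using hp, rfl⟩

theorem zmod_three_cases (a : ZMod 3) : a = 0 ∨ a = 1 ∨ a = 2 := by
  revert a; decide

omit [Module (ZMod 3) V] in
theorem ncard_ne_zero_eq [Finite V] : {b : V | b ≠ 0}.ncard = Nat.card V - 1 := by
  rw [show {b : V | b ≠ 0} = {0}ᶜ from rfl, Set.ncard_compl, Set.ncard_singleton]

theorem ncard_zmod_three_ne_zero : {a : ZMod 3 | a ≠ 0}.ncard = 2 := by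
  rw [ncard_ne_zero_eq, Nat.card_zmod]

omit [Module (ZMod 3) V] in
theorem ncard_setOf_fst_ne_zero_snd_eq_zero : {p : ZMod 3 × V | p.1 ≠ 0 ∧ p.2 = 0}.ncard = 2 := by
  rw [show {p : ZMod 3 × V | p.1 ≠ 0 ∧ p.2 = 0} = {a : ZMod 3 | a ≠ 0} ×ˢ {(0 : V)} from rfl,
    Set.ncard_prod, ncard_zmod_three_ne_zero, Set.ncard_singleton]

omit [Module (ZMod 3) V] in
theorem ncard_setOf_fst_eq_zero_snd_ne_zero [Finite V] :
    {p : ZMod 3 × V | p.1 = 0 ∧ p.2 ≠ 0}.ncard = Nat.card V - 1 := by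
  rw [show {p : ZMod 3 × V | p.1 = 0 ∧ p.2 ≠ 0} = {(0 : ZMod 3)} ×ˢ {b : V | b ≠ 0} from rfl,
    Set.ncard_prod, ncard_ne_zero_eq, Set.ncard_singleton, one_mul]

omit [Module (ZMod 3) V] in
theorem ncard_setOf_fst_ne_zero_snd_ne_zero [Finite V] :
    {p : ZMod 3 × V | p.1 ≠ 0 ∧ p.2 ≠ 0}.ncard = 2 * (Nat.card V - 1) := by
  rw [show {p : ZMod 3 × V | p.1 ≠ 0 ∧ p.2 ≠ 0} = {a : ZMod 3 | a ≠ 0} ×ˢ {b : V | b ≠ 0} from rfl,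
    Set.ncard_prod, ncard_zmod_three_ne_zero, ncard_ne_zero_eq]

/-- The weight distribution when the weight of the word of `(a, b)` depends only on whether
`a` and `b` vanish. -/
theorem three_weight_distribution [Finite V] [Nontrivial V] {w₁ w₂ : ℕ} (hw0 : 0 < w₁) (hw12 : w₁ < w₂)
    (hw2n : w₂ < n) (h0 : ∀ b : V, b ≠ 0 → hammingNorm (e (0, b) : Fin n → ZMod 3) = w₂)
    (h1 : ∀ a, a ≠ 0 → ∀ b : V, b ≠ 0 → hammingNorm (e (a, b) : Fin n → ZMod 3) = w₁)
    (h2 : ∀ a, a ≠ 0 → hammingNorm (e (a, 0) : Fin n → ZMod 3) = n) :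
    IsMinDistance C w₁ ∧ IsWeightCode C 3 ∧
    (∀ c ∈ C, (hammingNorm c : ℚ) ∈ ({0, (w₁ : ℚ), (w₂ : ℚ), (n : ℚ)} : Set ℚ)) ∧
    weightFrequency C 0 = 1 ∧ weightFrequency C w₁ = 2 * (Nat.card V - 1) ∧
    weightFrequency C w₂ = Nat.card V - 1 ∧ weightFrequency C n = 2 := by
  classical
  have h00 : hammingNorm (e (0, 0) : Fin n → ZMod 3) = 0 :=
    (hammingNorm_equiv_eq_zero_iff e _).2 rfl
  obtain ⟨b₀, hb₀⟩ := exists_ne (0 : V)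
  have hcases : ∀ p : ZMod 3 × V, hammingNorm (e p : Fin n → ZMod 3) =
      if p.1 = 0 then (if p.2 = 0 then 0 else w₂) else (if p.2 = 0 then n else w₁) := by
    rintro ⟨a, b⟩
    by_cases ha : a = 0 <;> by_cases hb : b = 0 <;> simp only [ha, hb, if_true, if_false]
    exacts [h00, h0 b hb, h2 a ha, h1 a ha b hb]
  have hwts : nonzeroWeights C = {w₁, w₂, n} := by
    rw [nonzeroWeights_eq e]
    ext w
    constructor
    · rintro ⟨⟨a, b⟩, hp, rfl⟩
      rw [hcases]
      by_cases ha : a = 0 <;> by_cases hb : b = 0 <;> simp_all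
    · rintro (rfl | rfl | rfl)
      · exact ⟨(1, b₀), by simp, h1 1 (by decide) b₀ hb₀⟩
      · exact ⟨(0, b₀), by simp [hb₀], h0 b₀ hb₀⟩
      · exact ⟨(1, 0), by simp, h2 1 (by decide)⟩
  have hfreq : ∀ (w : ℕ) (P : Set (ZMod 3 × V)),
      (∀ p, (hammingNorm (e p : Fin n → ZMod 3) = w ↔ p ∈ P)) →
      weightFrequency C (w : ℚ) = P.ncard := fun w P hP => by
    rw [weightFrequency_eq_ncard e]
    exact congrArg Set.ncard (Set.ext hP)
  refine ⟨isMinDistance_of_isLeast ?_, ⟨?_, ?_⟩, ?_, ?_, ?_, ?_, ?_⟩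
  · rw [hwts]
    refine ⟨by simp, ?_⟩
    rintro w (rfl | rfl | rfl) <;> omega
  · rw [hwts]; exact Set.toFinite _
  · rw [hwts, Set.ncard_eq_toFinset_card']
    simp [hw12.ne, hw2n.ne, (hw12.trans hw2n).ne]
  · intro c hc
    obtain ⟨p, hp⟩ := e.surjective ⟨c, hc⟩
    have h3 := hcases p
    rw [hp] at h3
    rw [h3]
    split_ifs <;> simp
  · rw [← Nat.cast_zero, hfreq 0 {0} fun p => hammingNorm_equiv_eq_zero_iff e p,
      Set.ncard_singleton]
  · rw [hfreq w₁ {p | p.1 ≠ 0 ∧ p.2 ≠ 0}, ncard_setOf_fst_ne_zero_snd_ne_zero]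
    intro p
    rw [hcases, Set.mem_ofPred_eq]
    split_ifs <;> simp [*] <;> omega
  · rw [hfreq w₂ {p | p.1 = 0 ∧ p.2 ≠ 0}, ncard_setOf_fst_eq_zero_snd_ne_zero]
    intro p
    rw [hcases, Set.mem_ofPred_eq]
    split_ifs <;> simp [*] <;> omega
  · rw [hfreq n {p | p.1 ≠ 0 ∧ p.2 = 0}, ncard_setOf_fst_ne_zero_snd_eq_zero]
    intro p
    rw [hcases, Set.mem_ofPred_eq]
    split_ifs <;> simp [*] <;> omega

/-- The weight distribution when, for each `b ≠ 0`, the words of `(1, b)` and `(2, b)` have the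
weights `w₁` and `w₃` in some order. -/
theorem four_weight_distribution [Finite V] [Nontrivial V] {w₀ w₁ w₃ : ℕ} (hw0 : 0 < w₁) (hw10 : w₁ < w₀)
    (hw03 : w₀ < w₃) (hw3n : w₃ < n)
    (h0 : ∀ b : V, b ≠ 0 → hammingNorm (e (0, b) : Fin n → ZMod 3) = w₀)
    (h1 : ∀ b : V, b ≠ 0 → (hammingNorm (e (1, b) : Fin n → ZMod 3) = w₁ ∧
        hammingNorm (e (2, b) : Fin n → ZMod 3) = w₃) ∨
      (hammingNorm (e (2, b) : Fin n → ZMod 3) = w₁ ∧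
        hammingNorm (e (1, b) : Fin n → ZMod 3) = w₃))
    (h2 : ∀ a, a ≠ 0 → hammingNorm (e (a, 0) : Fin n → ZMod 3) = n) :
    IsMinDistance C w₁ ∧ IsWeightCode C 4 ∧
    (∀ c ∈ C, (hammingNorm c : ℚ) ∈ ({0, (w₀ : ℚ), (w₁ : ℚ), (w₃ : ℚ), (n : ℚ)} : Set ℚ)) ∧
    weightFrequency C 0 = 1 ∧ weightFrequency C w₀ = Nat.card V - 1 ∧
    weightFrequency C w₁ = Nat.card V - 1 ∧ weightFrequency C w₃ = Nat.card V - 1 ∧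
    weightFrequency C n = 2 := by
  classical
  have h00 : hammingNorm (e (0, 0) : Fin n → ZMod 3) = 0 :=
    (hammingNorm_equiv_eq_zero_iff e _).2 rfl
  obtain ⟨b₀, hb₀⟩ := exists_ne (0 : V)
  -- for each `b`, the constant that yields the weight `w₁`
  obtain ⟨s, hs0, hs⟩ : ∃ s : V → ZMod 3, (∀ b, s b ≠ 0) ∧ ∀ b, b ≠ 0 → ∀ a, a ≠ 0 →
      hammingNorm (e (a, b) : Fin n → ZMod 3) = if a = s b then w₁ else w₃ := by
    refine ⟨fun b => if hammingNorm (e (1, b) : Fin n → ZMod 3) = w₁ then 1 else 2,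
      fun b => ?_, fun b hb a ha => ?_⟩
    · dsimp only; split_ifs <;> decide
    · have d1 : (1 : ZMod 3) ≠ 2 := by decide
      have hne : w₃ ≠ w₁ := by omega
      rcases (zmod_three_cases a).resolve_left ha with rfl | rfl <;>
      rcases h1 b hb with ⟨k1, k2⟩ | ⟨k1, k2⟩ <;> simp [k1, k2, d1, d1.symm, hne]
  have hcases : ∀ p : ZMod 3 × V, hammingNorm (e p : Fin n → ZMod 3) =
      if p.1 = 0 then (if p.2 = 0 then 0 else w₀)
      else (if p.2 = 0 then n else if p.1 = s p.2 then w₁ else w₃) := by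
    rintro ⟨a, b⟩
    by_cases ha : a = 0 <;> by_cases hb : b = 0 <;> simp only [ha, hb, if_true, if_false]
    exacts [h00, h0 b hb, h2 a ha, hs b hb a ha]
  have hs2 : ∀ z : ZMod 3, z ≠ 0 → -z ≠ 0 ∧ -z ≠ z := by decide
  have hs3 : ∀ z a : ZMod 3, z ≠ 0 → a ≠ 0 → a ≠ z → a = -z := by decide
  have hwts : nonzeroWeights C = {w₀, w₁, w₃, n} := by
    rw [nonzeroWeights_eq e]
    ext w
    constructor
    · rintro ⟨⟨a, b⟩, hp, rfl⟩
      rw [hcases]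
      by_cases ha : a = 0 <;> by_cases hb : b = 0 <;> by_cases hc : a = s b <;> simp_all
    · rintro (rfl | rfl | rfl | rfl)
      · exact ⟨(0, b₀), by simp [hb₀], h0 b₀ hb₀⟩
      · exact ⟨(s b₀, b₀), by simp [hb₀], by rw [hs b₀ hb₀ _ (hs0 _), if_pos rfl]⟩
      · exact ⟨(-s b₀, b₀), by simp [hb₀], by
          rw [hs b₀ hb₀ _ (hs2 _ (hs0 _)).1, if_neg (hs2 _ (hs0 _)).2]⟩
      · exact ⟨(1, 0), by simp, h2 1 (by decide)⟩
  have hfreq : ∀ (w : ℕ) (P : Set (ZMod 3 × V)),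
      (∀ p, (hammingNorm (e p : Fin n → ZMod 3) = w ↔ p ∈ P)) →
      weightFrequency C (w : ℚ) = P.ncard := fun w P hP => by
    rw [weightFrequency_eq_ncard e]
    exact congrArg Set.ncard (Set.ext hP)
  have hgraph : ∀ r : V → ZMod 3, ((fun b => (r b, b)) '' {b : V | b ≠ 0}).ncard =
      Nat.card V - 1 := fun r => by
    rw [Set.ncard_image_of_injective _ fun b b' h => congrArg Prod.snd h, ncard_ne_zero_eq]
  refine ⟨isMinDistance_of_isLeast ?_, ⟨?_, ?_⟩, ?_, ?_, ?_, ?_, ?_, ?_⟩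
  · rw [hwts]
    refine ⟨by simp, ?_⟩
    rintro w (rfl | rfl | rfl | rfl) <;> omega
  · rw [hwts]; exact Set.toFinite _
  · rw [hwts, Set.ncard_eq_toFinset_card']
    have d1 : w₀ ≠ n := by omega
    have d2 : w₁ ≠ w₃ := by omega
    have d3 : w₁ ≠ n := by omega
    simp [hw10.ne', hw03.ne, hw3n.ne, d1, d2, d3]
  · intro c hc
    obtain ⟨p, hp⟩ := e.surjective ⟨c, hc⟩
    have h3 := hcases p
    rw [hp] at h3
    rw [h3]
    split_ifs <;> simp
  · rw [← Nat.cast_zero, hfreq 0 {0} fun p => hammingNorm_equiv_eq_zero_iff e p,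
      Set.ncard_singleton]
  · rw [hfreq w₀ {p | p.1 = 0 ∧ p.2 ≠ 0}, ncard_setOf_fst_eq_zero_snd_ne_zero]
    intro p
    rw [hcases, Set.mem_ofPred_eq]
    split_ifs <;> simp [*] <;> omega
  -- The words of weight w₁ form the graph of s over b ≠ 0; those of weight w₃ form the graph of -s.
  · rw [hfreq w₁ ((fun b => (s b, b)) '' {b : V | b ≠ 0}), hgraph]
    rintro ⟨a, b⟩
    rw [hcases]
    constructor
    · intro h
      split_ifs at h with k1 k2 k2 k3 <;> first | omega | exact ⟨b, k2, Prod.ext k3.symm rfl⟩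
    · rintro ⟨b', hb', h⟩
      obtain ⟨rfl, rfl⟩ := Prod.ext_iff.1 h
      rw [if_neg (hs0 _), if_neg hb', if_pos rfl]
  · rw [hfreq w₃ ((fun b => (-s b, b)) '' {b : V | b ≠ 0}), hgraph]
    rintro ⟨a, b⟩
    rw [hcases]
    constructor
    · intro h
      split_ifs at h with k1 k2 k2 k3 <;>
        first | omega | exact ⟨b, k2, Prod.ext (hs3 _ _ (hs0 b) k1 k3).symm rfl⟩
    · rintro ⟨b', hb', h⟩
      obtain ⟨rfl, rfl⟩ := Prod.ext_iff.1 h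
      rw [if_neg (hs2 _ (hs0 _)).1, if_neg hb', if_neg (hs2 _ (hs0 _)).2]
  · rw [hfreq n {p | p.1 ≠ 0 ∧ p.2 = 0}, ncard_setOf_fst_ne_zero_snd_eq_zero]
    intro p
    rw [hcases, Set.mem_ofPred_eq]
    split_ifs <;> simp [*] <;> omega

end Distribution

/-! ### Assembly for odd and even m. -/

section Main

theorem exists_designed_distance {m h : ℕ} (hm : 2 * h + 1 ≤ m) :
    ∃ δ, 2 * δ + 3 ^ h + 1 = 2 * 3 ^ (m - 1) := by
  obtain ⟨r, hr⟩ : Odd (3 ^ h) := Odd.pow (by decide)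
  have h1 : 3 ^ h ≤ 3 ^ (m - 1) := Nat.pow_le_pow_right (by norm_num) (by omega)
  exact ⟨3 ^ (m - 1) - r - 1, by omega⟩

theorem finrank_eq_of_natCard_eq {V : Type*} [AddCommGroup V] [Module (ZMod 3) V] [Finite V] {d : ℕ}
    (hV : Nat.card V = 3 ^ d) : Module.finrank (ZMod 3) V = d := by
  have : Fact (Nat.Prime 3) := ⟨Nat.prime_three⟩
  have h := Module.natCard_eq_pow_finrank (K := ZMod 3) (V := V)
  rw [hV, Nat.card_zmod] at h
  exact (Nat.pow_right_injective (by norm_num) h).symm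

theorem finrank_eq_add_one_of_equiv {V W : Type*} [AddCommGroup V] [Module (ZMod 3) V] [Finite V]
    [AddCommGroup W] [Module (ZMod 3) W] (e : (ZMod 3 × V) ≃ₗ[ZMod 3] W) :
    Module.finrank (ZMod 3) W = Module.finrank (ZMod 3) V + 1 := by
  have : Fact (Nat.Prime 3) := ⟨Nat.prime_three⟩
  rw [← e.finrank_eq, Module.finrank_prod, Module.finrank_self, add_comm]

variable {F : Type*} [Field F]

/-- The exponents add up to 3^(h+1) + 1 + 6δ = 4n. Using 3δ in place of δ stays in the same coset
and makes θ the power 3^(h+1) + 1 of g. -/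
theorem generator_pow_mul_pow_eq_one {m h n δ : ℕ} {g : F} (hm : 0 < m) (hn : 2 * n + 1 = 3 ^ m)
    (hδ : 2 * δ + 3 ^ h + 1 = 2 * 3 ^ (m - 1)) (hg : IsPrimitiveRoot g (2 * n)) :
    g ^ (3 ^ (h + 1) + 1) * (g ^ 2) ^ (3 * δ) = 1 := by
  have h3m : 3 ^ m = 3 * 3 ^ (m - 1) := by rw [← pow_succ']; congr 1; omega
  have e : 3 ^ (h + 1) + 1 + 2 * (3 * δ) = 2 * n * 2 := by rw [pow_succ]; omega
  rw [← pow_mul, ← pow_add, e, pow_mul, hg.pow_eq_one, one_pow]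

theorem isPrimitiveRoot_of_generator {m n : ℕ} (hn : 2 * n + 1 = 3 ^ m)
    (hF : Nat.card F = 3 ^ m) {α : Fˣ} (hα : ∀ x : Fˣ, x ∈ Subgroup.zpowers α) :
    IsPrimitiveRoot (α : F) (2 * n) := by
  have h : orderOf α = 2 * n := by
    rw [orderOf_eq_card_of_forall_mem_zpowers hα, Nat.card_units, hF]; omega
  rw [IsPrimitiveRoot.coe_units_iff, ← h]
  exact IsPrimitiveRoot.orderOf α

variable [Algebra (ZMod 3) F]

theorem eq_zero_of_traceWord_eq_zero {n : ℕ} {θ : F} (hn : 0 < n)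
    {a : ZMod 3} {b : F} (hb : hammingNorm (traceWord n θ (a, b)) = 0 → b = 0) (h : traceWord n θ (a, b) = 0) : a = 0 ∧ b = 0 := by
  obtain rfl := hb (hammingNorm_eq_zero.2 h)
  refine ⟨?_, rfl⟩
  by_contra ha
  have := hammingNorm_traceWord_zero (n := n) (θ := θ) ha
  rw [h, hammingNorm_zero] at this
  omega

theorem exists_distribution_of_odd [Finite F] {h n δ : ℕ} (hh : 1 ≤ h)
    (hn : 2 * n + 1 = 3 ^ (2 * h + 1)) (hF : Nat.card F = 3 ^ (2 * h + 1)) {g : F}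
    (hg : IsPrimitiveRoot g (2 * n)) (hδ : IsGreatest (cosetLeaders 3 n) δ)
    {C : Submodule (ZMod 3) (Fin n → ZMod 3)} (hC : C = bchCode (ZMod 3) n (g ^ 2) δ) :
    ∃ w₃ : ℕ, 2 * δ + 3 ^ h + 1 = 2 * 3 ^ (2 * h) ∧ 2 * w₃ + 1 = 2 * 3 ^ (2 * h) + 3 ^ h ∧
    Module.finrank (ZMod 3) C = 2 * h + 1 + 1 ∧ IsMinDistance C δ ∧ IsWeightCode C 4 ∧
    (∀ c ∈ C, (hammingNorm c : ℚ) ∈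
      ({0, ((3 ^ (2 * h) : ℕ) : ℚ), (δ : ℚ), (w₃ : ℚ), (n : ℚ)} : Set ℚ)) ∧
    weightFrequency C 0 = 1 ∧ weightFrequency C ((3 ^ (2 * h) : ℕ) : ℚ) = 3 ^ (2 * h + 1) - 1 ∧
    weightFrequency C δ = 3 ^ (2 * h + 1) - 1 ∧ weightFrequency C w₃ = 3 ^ (2 * h + 1) - 1 ∧
    weightFrequency C n = 2 := by
  subst hC
  obtain ⟨δ', hδ'⟩ := exists_designed_distance (m := 2 * h + 1) le_rfl
  obtain rfl := isGreatest_cosetLeaders_eq le_rfl (by omega) hn hδ' hδ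
  -- With 3^h = 2r + 1, the weights other than 3^(2h) and n are δ = 3^(2h) - r - 1 and w₃ = 3^(2h) +
  -- r.
  obtain ⟨r, hr⟩ : Odd (3 ^ h) := Odd.pow (by decide)
  have hq3 : 3 ^ 1 ≤ 3 ^ h := Nat.pow_le_pow_right (by norm_num) hh
  have hq2 : 3 ^ (2 * h) = 3 ^ h * 3 ^ h := by rw [two_mul, pow_add]
  have hm3 : 3 ^ (2 * h + 1) = 3 * 3 ^ (2 * h) := pow_succ' _ _
  have hbig : 3 * 3 ^ h ≤ 3 ^ (2 * h) := by rw [hq2]; exact Nat.mul_le_mul_right _ hq3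
  rw [Nat.add_sub_cancel] at hδ'
  have hβ : IsPrimitiveRoot (g ^ 2) n := hg.pow (by omega) rfl
  have hθ := generator_pow_mul_pow_eq_one (h := h) (by omega) hn (by simpa using hδ') hg
  have hw := fun (b : F) (hb : b ≠ 0) =>
    hammingNorm_traceWord_of_odd hn hF hg hb (W := fun a => _) fun _ => rfl
  have hinj : ∀ (a : ZMod 3) (b : F),
      hammingNorm (traceWord n (g ^ (3 ^ (h + 1) + 1)) (a, b)) = 0 → b = 0 := by
    intro a b hab
    by_contra hb
    have H := hw b hb
    rcases zmod_three_cases a with rfl | rfl | rfl <;> omega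
  obtain ⟨e, he⟩ := exists_linearEquiv_bchCode hn (by omega) hβ hδ hθ ⊤ (fun _ _ => trivial)
    (fun a b _ => eq_zero_of_traceWord_eq_zero (by omega) (hinj a b))
  have hcard : Nat.card (⊤ : Submodule (ZMod 3) F) = 3 ^ (2 * h + 1) := by
    rw [Nat.card_congr Submodule.topEquiv.toEquiv, hF]
  have hnt : Nontrivial (⊤ : Submodule (ZMod 3) F) := by
    rw [← Finite.one_lt_card_iff_nontrivial, hcard]; omega
  have hne : ∀ b : (⊤ : Submodule (ZMod 3) F), b ≠ 0 → (b : F) ≠ 0 := fun b hb h0 =>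
    hb (Subtype.ext h0)
  have main := four_weight_distribution e (w₀ := 3 ^ (2 * h)) (w₁ := δ)
    (w₃ := 3 ^ (2 * h) + r) (by omega) (by omega) (by omega) (by omega)
    (fun b hb => by rw [he]; exact (hw b (hne b hb)).1)
    (fun b hb => by
      have H := hw b (hne b hb)
      rw [he, he]
      omega)
    (fun a ha => by rw [he]; exact hammingNorm_traceWord_zero ha)
  rw [hcard] at main
  obtain ⟨m1, m2, m3, m4, m5, m6, m7, m8⟩ := main
  refine ⟨3 ^ (2 * h) + r, hδ', by omega, ?_, m1, m2, m3, m4, m5, m6, m7, m8⟩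
  rw [finrank_eq_add_one_of_equiv e, finrank_eq_of_natCard_eq hcard]

/-- For m = 2h + 2 the two digits 1 of 2(n-δ) are diametrically opposite, so a half turn fixes the
word. With q = 3^h, 2δ = (3q+1)(2q-1) and 2n = (3q+1)(3q-1), whence δ(3q-1) = n(2q-1). This confines
the values c(β^δ) to GF(3^(h+1)). -/
theorem designed_distance_mul_modEq {h n δ : ℕ} (hn : 2 * n + 1 = 3 ^ (2 * h + 2))
    (hδ : 2 * δ + 3 ^ h + 1 = 2 * 3 ^ (2 * h + 1)) : δ * 3 ^ (h + 1) ≡ δ [MOD n] := by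
  have hcop : Nat.gcd n 3 = 1 := by
    refine (Nat.coprime_comm.1 ((Nat.prime_three.coprime_iff_not_dvd).2 fun hd => ?_))
    have : 3 ∣ 3 ^ (2 * h + 2) := dvd_pow_self 3 (by omega)
    omega
  refine Nat.ModEq.cancel_left_of_coprime hcop ?_
  obtain ⟨q, hq⟩ : ∃ q, 3 ^ h = q := ⟨_, rfl⟩
  have e1 : 3 ^ (2 * h + 2) = 9 * q ^ 2 := by rw [← hq]; ring
  have e2 : 3 ^ (2 * h + 1) = 3 * q ^ 2 := by rw [← hq]; ring
  rw [e1] at hn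
  rw [hq, e2] at hδ
  rw [pow_succ, hq]
  have key : 3 * (δ * (q * 3)) + n * 3 = 3 * δ + n * (6 * q) := by
    zify at *
    have hδ2 : (δ : ℤ) * 2 = 6 * q ^ 2 - q - 1 := by linarith
    have hn2 : (n : ℤ) * 2 = 9 * q ^ 2 - 1 := by linarith
    have : (2 : ℤ) * (3 * (δ * (q * 3)) + n * 3) = 2 * (3 * δ + n * (6 * q)) := by
      linear_combination (9 * q - 3 : ℤ) * hδ2 + (3 - 6 * q : ℤ) * hn2
    linarith
  have h1 : 3 * (δ * (q * 3)) + n * 3 ≡ 3 * (δ * (q * 3)) [MOD n] := by simp [Nat.ModEq]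
  have h2 : 3 * δ + n * (6 * q) ≡ 3 * δ [MOD n] := by simp [Nat.ModEq]
  exact h1.symm.trans (key ▸ h2)

theorem exists_distribution_of_even [Finite F] {h n δ : ℕ} (hh : 1 ≤ h)
    (hn : 2 * n + 1 = 3 ^ (2 * h + 2)) (hF : Nat.card F = 3 ^ (2 * h + 2)) {g : F}
    (hg : IsPrimitiveRoot g (2 * n)) (hδ : IsGreatest (cosetLeaders 3 n) δ)
    {C : Submodule (ZMod 3) (Fin n → ZMod 3)} (hC : C = bchCode (ZMod 3) n (g ^ 2) δ) :
    2 * δ + 3 ^ h + 1 = 2 * 3 ^ (2 * h + 1) ∧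
    Module.finrank (ZMod 3) C = h + 1 + 1 ∧ IsMinDistance C δ ∧ IsWeightCode C 3 ∧
    (∀ c ∈ C, (hammingNorm c : ℚ) ∈
      ({0, (δ : ℚ), ((3 ^ (2 * h + 1) + 3 ^ h : ℕ) : ℚ), (n : ℚ)} : Set ℚ)) ∧
    weightFrequency C 0 = 1 ∧ weightFrequency C δ = 2 * (3 ^ (h + 1) - 1) ∧
    weightFrequency C ((3 ^ (2 * h + 1) + 3 ^ h : ℕ) : ℚ) = 3 ^ (h + 1) - 1 ∧
    weightFrequency C n = 2 := by
  subst hC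
  obtain ⟨δ', hδ'⟩ := exists_designed_distance (m := 2 * h + 2) (h := h) (by omega)
  obtain rfl := isGreatest_cosetLeaders_eq (by omega) le_rfl hn hδ' hδ
  have hδ'' : 2 * δ + 3 ^ h + 1 = 2 * 3 ^ (2 * h + 1) := by simpa using hδ'
  have hq3 : 3 ^ 1 ≤ 3 ^ h := Nat.pow_le_pow_right (by norm_num) hh
  have hl3 : 3 ^ (h + 1) = 3 * 3 ^ h := pow_succ' _ _
  have hq2 : 3 ^ (2 * h + 1) = 3 ^ (h + 1) * 3 ^ h := by rw [← pow_add]; congr 1; omega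
  have hm3 : 3 ^ (2 * h + 2) = 3 * 3 ^ (2 * h + 1) := pow_succ' _ _
  have hbig : 9 * 3 ^ h ≤ 3 ^ (2 * h + 1) := by
    rw [hq2]; exact Nat.mul_le_mul_right _ (by omega)
  have hβ : IsPrimitiveRoot (g ^ 2) n := hg.pow (by omega) rfl
  have hθ := generator_pow_mul_pow_eq_one (h := h) (by omega) hn hδ' hg
  have hγ : IsPrimitiveRoot (g ^ (3 ^ (h + 1) + 1)) (3 ^ (h + 1) - 1) := by
    refine hg.pow (by omega) ?_
    rw [← Nat.sq_sub_sq (3 ^ (h + 1)) 1, ← pow_mul, show (h + 1) * 2 = 2 * h + 2 by ring, ← hn]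
    simp
  have hw := fun (b : F) (hb : b ≠ 0) hbK a =>
    hammingNorm_traceWord_of_even (Nat.succ_pos h) hn hF hγ hb hbK a
  rw [show 2 * h.succ - 1 = 2 * h + 1 by omega, Nat.succ_sub_one] at hw
  have hinj : ∀ a : ZMod 3, ∀ b ∈ frobeniusFixed F (h + 1),
      traceWord n (g ^ (3 ^ (h + 1) + 1)) (a, b) = 0 → a = 0 ∧ b = 0 := by
    intro a b hbK hab
    refine eq_zero_of_traceWord_eq_zero (by omega) (fun _ => ?_) hab
    by_contra hb
    have H := hw b hb hbK a
    rw [hab, hammingNorm_zero] at H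
    split_ifs at H <;> omega
  obtain ⟨e, he⟩ := exists_linearEquiv_bchCode hn (by omega) hβ hδ hθ (frobeniusFixed F (h + 1))
    (fun c _ => by
      rw [mem_frobeniusFixed, ← spectrumAt_pow_three]
      exact spectrumAt_congr hβ.pow_eq_one c (designed_distance_mul_modEq hn hδ''))
    hinj
  have hcard := card_frobeniusFixed (Nat.succ_pos h) hγ
  have hnt : Nontrivial (frobeniusFixed F (h + 1)) := by
    rw [← Finite.one_lt_card_iff_nontrivial, hcard]; omega
  have hne : ∀ b : frobeniusFixed F (h + 1), b ≠ 0 → (b : F) ≠ 0 := fun b hb h0 =>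
    hb (Subtype.ext h0)
  have main := three_weight_distribution e (w₁ := δ) (w₂ := 3 ^ (2 * h + 1) + 3 ^ h)
    (by omega) (by omega) (by omega)
    (fun b hb => by
      have H := hw b (hne b hb) b.2 0
      rw [if_pos rfl] at H
      rw [he]
      omega)
    (fun a ha b hb => by
      have H := hw b (hne b hb) b.2 a
      rw [if_neg ha] at H
      rw [he]
      omega)
    (fun a ha => by rw [he]; exact hammingNorm_traceWord_zero ha)
  rw [hcard] at main
  obtain ⟨m1, m2, m3, m4, m5, m6, m7⟩ := main
  refine ⟨hδ'', ?_, m1, m2, m3, m4, m5, m6, m7⟩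
  rw [finrank_eq_add_one_of_equiv e, finrank_eq_of_natCard_eq hcard]

end Main

theorem mainTheorem3 (m : ℕ) (hm : 3 ≤ m)
    (n : ℕ) (hn : n = (3 ^ m - 1) / 2)
    (F : Type*) [Field F] [Algebra (ZMod 3) F] (hF : Nat.card F = 3 ^ m)
    (α : Fˣ) (hα : ∀ x : Fˣ, x ∈ Subgroup.zpowers α)
    (β : F) (hβ : β = (α : F) ^ ((3 ^ m - 1) / n))
    (δ₁ : ℕ) (hδ₁ : IsGreatest (cosetLeaders 3 n) δ₁)
    (C : Submodule (ZMod 3) (Fin n → ZMod 3)) (hC : C = bchCode (ZMod 3) n β δ₁) :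
    IsMinDistance C δ₁ ∧
    (Odd m → Module.finrank (ZMod 3) C = m + 1) ∧
    (Even m → Module.finrank (ZMod 3) C = (m + 2) / 2) ∧
    (Even m →
      IsWeightCode C 3 ∧
      (∀ c ∈ C, (hammingNorm c : ℚ) ∈
        ({0,
          3 ^ (m - 1) - (3 ^ (m / 2 - 1) + 1) / 2,
          3 ^ (m - 1) + 3 ^ (m / 2 - 1),
          (3 ^ m - 1) / 2} : Set ℚ)) ∧
      weightFrequency C 0 = 1 ∧
      weightFrequency C (3 ^ (m - 1) - (3 ^ (m / 2 - 1) + 1) / 2) = 2 * (3 ^ (m / 2) - 1) ∧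
      weightFrequency C (3 ^ (m - 1) + 3 ^ (m / 2 - 1)) = 3 ^ (m / 2) - 1 ∧
      weightFrequency C ((3 ^ m - 1) / 2) = 2) ∧
    (Odd m →
      IsWeightCode C 4 ∧
      (∀ c ∈ C, (hammingNorm c : ℚ) ∈
        ({0,
          3 ^ (m - 1),
          3 ^ (m - 1) - (1 + (-1) ^ ((m - 1) / 2) * 3 ^ ((m - 1) / 2)) / 2,
          3 ^ (m - 1) - (1 + (-1) ^ ((m + 1) / 2) * 3 ^ ((m - 1) / 2)) / 2,
          (3 ^ m - 1) / 2} : Set ℚ)) ∧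
      weightFrequency C 0 = 1 ∧
      weightFrequency C (3 ^ (m - 1)) = 3 ^ m - 1 ∧
      weightFrequency C (3 ^ (m - 1) - (1 + (-1) ^ ((m - 1) / 2) * 3 ^ ((m - 1) / 2)) / 2)
        = 3 ^ m - 1 ∧
      weightFrequency C (3 ^ (m - 1) - (1 + (-1) ^ ((m + 1) / 2) * 3 ^ ((m - 1) / 2)) / 2)
        = 3 ^ m - 1 ∧
      weightFrequency C ((3 ^ m - 1) / 2) = 2) := by
  have hmod : 2 * n + 1 = 3 ^ m := by
    obtain ⟨r, hr⟩ : Odd (3 ^ m) := Odd.pow (by decide)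
    omega
  have hn0 : 0 < n := by
    have : 3 ^ 3 ≤ 3 ^ m := Nat.pow_le_pow_right (by norm_num) hm
    omega
  have : Finite F := Nat.finite_of_card_ne_zero (by rw [hF]; positivity)
  have hg := isPrimitiveRoot_of_generator hmod hF hα
  have hquot : (3 ^ m - 1) / n = 2 := by
    rw [← hmod, Nat.add_sub_cancel, Nat.mul_div_cancel _ hn0]
  rw [hquot] at hβ
  rw [hβ] at hC
  have hnQ : ((3 : ℚ) ^ m - 1) / 2 = n := by
    have : (2 * n + 1 : ℚ) = 3 ^ m := by exact_mod_cast hmod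
    linarith
  rw [hnQ]
  rcases Nat.even_or_odd' m with ⟨l, rfl | rfl⟩
  · obtain ⟨h, rfl⟩ : ∃ h, l = h + 1 := ⟨l - 1, by omega⟩
    obtain ⟨k1, k2, k3, k4, k5, k6, k7, k8, k9⟩ :=
      exists_distribution_of_even (h := h) (by omega) hmod hF hg hδ₁ hC
    have hodd : ¬ Odd (2 * (h + 1)) := Nat.not_odd_iff_even.2 (even_two_mul _)
    have e1 : ((3 : ℚ) ^ (2 * (h + 1) - 1) - (3 ^ (2 * (h + 1) / 2 - 1) + 1) / 2) = δ₁ := by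
      rw [show 2 * (h + 1) - 1 = 2 * h + 1 by omega, show 2 * (h + 1) / 2 - 1 = h by omega]
      have : (2 * δ₁ + 3 ^ h + 1 : ℚ) = 2 * 3 ^ (2 * h + 1) := by exact_mod_cast k1
      linarith
    have e2 : ((3 : ℚ) ^ (2 * (h + 1) - 1) + 3 ^ (2 * (h + 1) / 2 - 1)) =
        ((3 ^ (2 * h + 1) + 3 ^ h : ℕ) : ℚ) := by
      rw [show 2 * (h + 1) - 1 = 2 * h + 1 by omega, show 2 * (h + 1) / 2 - 1 = h by omega]
      push_cast
      rfl
    rw [e1, e2, show 2 * (h + 1) / 2 = h + 1 by omega]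
    exact ⟨k3, fun H => absurd H hodd, fun _ => by rw [k2]; omega,
      fun _ => ⟨k4, k5, k6, k7, k8, k9⟩, fun H => absurd H hodd⟩
  · obtain ⟨w, k1, k2, k3, k4, k5, k6, k7, k8, k9, k10, k11⟩ :=
      exists_distribution_of_odd (h := l) (by omega) hmod hF hg hδ₁ hC
    have heven : ¬ Even (2 * l + 1) := Nat.not_even_iff_odd.2 (odd_two_mul_add_one l)
    have e0 : (3 : ℚ) ^ (2 * l + 1 - 1) = ((3 ^ (2 * l) : ℕ) : ℚ) := by
      rw [Nat.add_sub_cancel]; push_cast; rfl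
    have c1 : (2 * δ₁ + 3 ^ l + 1 : ℚ) = 2 * ((3 ^ (2 * l) : ℕ) : ℚ) := by exact_mod_cast k1
    have c2 : (2 * w + 1 : ℚ) = 2 * ((3 ^ (2 * l) : ℕ) : ℚ) + 3 ^ l := by exact_mod_cast k2
    rw [e0, show (2 * l + 1 - 1) / 2 = l by omega, show (2 * l + 1 + 1) / 2 = l + 1 by omega,
      pow_succ (-1 : ℚ)]
    refine ⟨k4, fun _ => k3, fun H => absurd H heven, fun H => absurd H heven, fun _ => ?_⟩
    -- The parity of l = (m-1)/2 decides which of the two signed formulas is δ₁ and which is w.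
    rcases Nat.even_or_odd l with hl | hl
    · rw [hl.neg_one_pow]
      have e1 : (((3 ^ (2 * l) : ℕ) : ℚ) - (1 + 1 * 3 ^ l) / 2) = δ₁ := by linarith
      have e2 : (((3 ^ (2 * l) : ℕ) : ℚ) - (1 + 1 * -1 * 3 ^ l) / 2) = w := by linarith
      rw [e1, e2]
      exact ⟨k5, k6, k7, k8, k9, k10, k11⟩
    · rw [hl.neg_one_pow]
      have e1 : (((3 ^ (2 * l) : ℕ) : ℚ) - (1 + -1 * 3 ^ l) / 2) = w := by linarith
      have e2 : (((3 ^ (2 * l) : ℕ) : ℚ) - (1 + -1 * -1 * 3 ^ l) / 2) = δ₁ := by linarith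
      rw [e1, e2, Set.insert_comm (w : ℚ)]
      exact ⟨k5, k6, k7, k8, k10, k9, k11⟩
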